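/- Let $k$ be a field that is finitely generated over $\mathbf{Q}$. Let $X$ be a smooth, proper, geometrically connected curve over $k$ with function field $K$, and let $C \subset X$ be a nonempty open subscheme. For a closed point $c$ of $C$, let $K_c$ be the completion of $K$ with respect to the discrete valuation associated with $c$, i.e. the normalised discrete valuation with valuation ring $\mathcal{O}_{X,c}$. Let $M$ be a finitely generated $\mathrm{Gal}(\overline{K}|K)$-module, that is, a finitely generated abelian group equipped with a continuous action of $\mathrm{Gal}(\overline{K}|K)$ for the discrete topology on $M$, considered as an étale locally constant commutative group scheme over $K$. For a field extension $L$ of $K$, let $H^i(L,M)$ be the continuous cohomology of $\mathrm{Gal}(\overline{L}|L)$ with values in $M$, where $\mathrm{Gal}(\overline{L}|L)$ acts on $M$ through the restriction map $\mathrm{Gal}(\overline{L}|L) \to \mathrm{Gal}(\overline{K}|K)$ given by an embedding $\overline{K} \hookrightarrow \overline{L}$ over $K$. Define $$\mathrm{Sha}^1_C(M) := \ker\Bigl(H^1(K,M) \to \prod_{c} H^1(K_c,M)\Bigr),$$ where $c$ runs over all closed points of $C$. Then $\mathrm{Sha}^1_C(M) = 0$. -/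

import Mathlib

open CategoryTheory AlgebraicGeometry Field
open scoped WithZero

universe u

noncomputable section

namespace TateShafarevich

section Galois

variable {K L : Type u} [Field K] [Field L] [Algebra K L]

/-- Elements of the absolute Galois group, as automorphisms of the algebraic closure. -/
def toAut : absoluteGaloisGroup K ≃* (AlgebraicClosure K ≃ₐ[K] AlgebraicClosure K) :=
  MulEquiv.refl _

/-- For a field extension `L` of `K` and a `K`-embedding `ι` of algebraic closures, the restriction
`τ ↦ ι⁻¹ ∘ τ ∘ ι` of an automorphism of the algebraic closure of `L` to that of `K`. -/
def restrictAut (ι : AlgebraicClosure K →ₐ[K] AlgebraicClosure L) (τ : absoluteGaloisGroup L) :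
    absoluteGaloisGroup K :=
  letI : Algebra (AlgebraicClosure K) (AlgebraicClosure L) := ι.toRingHom.toAlgebra
  haveI : IsScalarTower K (AlgebraicClosure K) (AlgebraicClosure L) :=
    IsScalarTower.of_algebraMap_eq fun x => (ι.commutes x).symm
  toAut.symm (AlgEquiv.restrictNormal (AlgEquiv.restrictScalars K (toAut τ)) (AlgebraicClosure K))

/-- The defining property of the restriction: `ι ((restrictAut ι τ) x) = τ (ι x)`. -/
theorem restrictAut_spec (ι : AlgebraicClosure K →ₐ[K] AlgebraicClosure L)
    (τ : absoluteGaloisGroup L) (x : AlgebraicClosure K) :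
    ι (toAut (restrictAut ι τ) x) = toAut τ (ι x) := by
  let _ : Algebra (AlgebraicClosure K) (AlgebraicClosure L) := ι.toRingHom.toAlgebra
  have _ : IsScalarTower K (AlgebraicClosure K) (AlgebraicClosure L) :=
    IsScalarTower.of_algebraMap_eq fun x => (ι.commutes x).symm
  exact AlgEquiv.restrictNormal_commutes (AlgEquiv.restrictScalars K (toAut τ))
    (AlgebraicClosure K) x

/-- The restriction, as a homomorphism of groups. -/
def restrictHom (ι : AlgebraicClosure K →ₐ[K] AlgebraicClosure L) :
    absoluteGaloisGroup L →* absoluteGaloisGroup K where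
  toFun := restrictAut ι
  map_one' := toAut.injective <| AlgEquiv.ext fun x => ι.injective <| by
    simp [restrictAut_spec]
  map_mul' σ τ := toAut.injective <| AlgEquiv.ext fun x => ι.injective <| by
    simp [restrictAut_spec]

theorem continuous_restrictHom (ι : AlgebraicClosure K →ₐ[K] AlgebraicClosure L) :
    Continuous (restrictHom ι) := by
  apply continuous_of_continuousAt_one
  rw [ContinuousAt, map_one]
  intro U hU
  obtain ⟨E, hE, hEU⟩ := (krullTopology_mem_nhds_one_iff K (AlgebraicClosure K) U).1 hU
  obtain ⟨s, rfl⟩ : E.FG := IntermediateField.essFiniteType_iff.1 inferInstance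
  let F : IntermediateField L (AlgebraicClosure L) := IntermediateField.adjoin L (ι '' (s : Set _))
  have hF : FiniteDimensional L F :=
    IntermediateField.finiteDimensional_adjoin fun x _ => Algebra.IsIntegral.isIntegral x
  refine (krullTopology_mem_nhds_one_iff L (AlgebraicClosure L) _).2 ⟨F, hF, fun τ hτ => hEU ?_⟩
  have hsF : IntermediateField.adjoin K (s : Set (AlgebraicClosure K)) ≤
      (F.restrictScalars K).comap ι :=
    IntermediateField.adjoin_le_iff.2 fun x hx =>
      IntermediateField.subset_adjoin L _ ⟨x, hx, rfl⟩
  refine (IntermediateField.mem_fixingSubgroup_iff _ _).2 fun x hx => ι.injective ?_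
  refine (restrictAut_spec ι τ x).trans ?_
  exact (IntermediateField.mem_fixingSubgroup_iff _ _).1 hτ (ι x) (hsF hx)

variable (K L) in
/-- The continuous homomorphism `Gal(L̄|L) → Gal(K̄|K)` attached to a field extension `L` of `K`,
for a chosen `K`-embedding of `K̄` in `L̄`. Another embedding changes it by an inner automorphism
of `Gal(K̄|K)`, which does not affect the kernels of the induced maps on cohomology. -/
def galRes : absoluteGaloisGroup L →ₜ* absoluteGaloisGroup K where
  toMonoidHom := restrictHom (IsAlgClosed.lift : AlgebraicClosure K →ₐ[K] AlgebraicClosure L)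
  continuous_toFun := continuous_restrictHom _

variable (L) in
/-- A (discrete) `Gal(K̄|K)`-module `M`, regarded as a `Gal(L̄|L)`-module. If `G` is the étale
`K`-group scheme with `G(K̄) = M`, this is the Galois module `G(L̄)` of `G ×_K L`. -/
abbrev baseChange (M : TopRep.{u} ℤ (absoluteGaloisGroup K)) :
    TopRep.{u} ℤ (absoluteGaloisGroup L) :=
  TopRep.res (galRes K L : absoluteGaloisGroup L →* absoluteGaloisGroup K) M

variable (L) in
/-- The restriction map `H^i(K, M) → H^i(L, M)` in Galois cohomology. -/
def resH (i : ℕ) (M : TopRep.{u} ℤ (absoluteGaloisGroup K)) :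
    continuousCohomology i M ⟶ continuousCohomology i (baseChange L M) :=
  ContinuousCohomology.map (galRes K L) (𝟙 (baseChange L M)) i

end Galois

section Completion

variable {K : Type u} [Field K] (v : Valuation K ℤᵐ⁰)

/-- The completion of a field `K` with respect to a valuation. -/
def CompletedField : Type u := v.Completion

instance : Field (CompletedField v) := inferInstanceAs (Field v.Completion)

instance : Algebra K (CompletedField v) :=
  ((UniformSpace.Completion.coeRingHom : WithVal v →+* v.Completion).comp
    (WithVal.equiv v).symm.toRingHom).toAlgebra

end Completion

section Curve

variable (X : Scheme.{u}) [IsIntegral X]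

/-- `v` is the normalised discrete valuation of the function field of `X` whose valuation ring is
the local ring of `X` at the point `c`. (At a closed point of a smooth curve there is exactly one
such `v`.) -/
structure IsDiscreteValuationAt (c : X) (v : Valuation X.functionField ℤᵐ⁰) : Prop where
  surjective : Function.Surjective v
  le_one_iff (x : X.functionField) :
    v x ≤ 1 ↔ x ∈ (algebraMap (X.presheaf.stalk c) X.functionField).range

/-- The Tate–Shafarevich group of `M` relative to `C`: the classes in `H^i(K, M)`, where `K` is the
function field of `X`, that vanish in `H^i(K_c, M)` for all closed points `c` of `C`. -/
def Sha (C : X.Opens) (i : ℕ) (M : TopRep.{u} ℤ (absoluteGaloisGroup X.functionField)) :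
    Submodule ℤ (continuousCohomology i M) :=
  ⨅ (c : C) (_ : c ∈ closedPoints C) (v : Valuation X.functionField ℤᵐ⁰)
    (_ : IsDiscreteValuationAt X c v),
    LinearMap.ker (resH (CompletedField v) i M).hom.toLinearMap

end Curve

end TateShafarevich

end

/-! ### Weighted finite differences of analytic germs -/

section

open Polynomial Filter Topology Asymptotics

/-! A class `α` in `H¹(K, M)` is controlled by a finite extension `E` of `K`: a cocycle for `α`
vanishes near `1`, and since `M` is finitely generated and discrete, a neighbourhood of `1` acts
trivially. If `L/K` is an extension for which `E ⊗ L` is still a field, then the image of `Gal(L)`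
meets every coset of `Gal(E)`, and a trivialisation of the restriction of `α` to `L` already
trivialises `α` (`exists_forall_eq_zero_of_resH_eq_zero`). So it suffices to find one closed point
`c` of `C` at which `E ⊗ K_c` is a field.

Such a point comes from Hilbert irreducibility. The field `k` is finite over a Hilbertian field `F`,
namely `ℚ` or a rational function field (`exists_isHilbertian_finiteDimensional`). A small affine
open of `C` has a coordinate ring `R` that is algebraic and of finite type over `F[X]`. Write `E =
F(X)(θ)` with `θ` integral over `F[X]`, and choose `a` in `F`, outside finitely many bad values,
such that the minimal polynomial of `θ` stays irreducible at `X = a`. Then the valuation at `a`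
extends to `E` as the maximum of the valuations of the coordinates (`gaussValuation`); its
restriction to `K` has a closed point of the open set as centre, with local ring equal to the
valuation ring (`exists_valuation_of_irreducible_eval`). Approximation then shows that `θ` keeps its
degree over `K_c` (`PowerBasis.irreducible_map_minpoly_of_valuation_repr_le`).

The Hilbert property itself is proved analytically, uniformly for `ℤ` in `ℂ` and for `F[X]` in the
Laurent series in `1/X` (`isHilbertian_of_norm`). After a translation, the roots of `f(u, Y)` are
analytic in `u` near `0`. If `f(1/m, Y)` is reducible for all large `m`, the coefficients of its
factors are analytic functions of `1/m` whose values have controlled denominators. A weighted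
difference of such values is an integral element that is small yet nonzero, unless the function is a
polynomial (`eventually_not_forall_exists_eq`). So the coefficients are polynomials, and they
produce a factorisation of `f`. -/

lemma exists_int_weights {n : ℕ} {ν : Fin (n + 1) → ℤ} (hν : Function.Injective ν) :
    ∃ w : Fin (n + 1) → ℤ, (∀ l < n, ∑ i, w i * ν i ^ l = 0) ∧ ∑ i, w i * ν i ^ n ≠ 0 := by
  have hdet : (Matrix.vandermonde ν).det ≠ 0 := Matrix.det_vandermonde_ne_zero_iff.2 hν
  have key (j : Fin (n + 1)) := congr_fun (congr_fun
    (Matrix.adjugate_mul (Matrix.vandermonde ν)) (Fin.last n)) j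
  simp only [Matrix.mul_apply, Matrix.vandermonde_apply, Matrix.smul_apply, smul_eq_mul] at key
  -- The last row of the adjugate is orthogonal to all columns of the Vandermonde matrix but the
  -- last, with which it pairs to the determinant.
  refine ⟨fun i => (Matrix.vandermonde ν).adjugate (Fin.last n) i, fun l hl => ?_, ?_⟩
  · have := key ⟨l, by omega⟩
    rw [Matrix.one_apply_ne (by simp [Fin.ext_iff]; omega)] at this
    simpa using this
  · have := key (Fin.last n)
    rw [Matrix.one_apply_eq] at this
    simp only [Fin.val_last, mul_one] at this
    rwa [this]

section Gap

variable {𝕜 : Type*} [NontriviallyNormedField 𝕜]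

lemma AnalyticAt.exists_polynomial_isBigO {φ : 𝕜 → 𝕜} (h : AnalyticAt 𝕜 φ 0) (n : ℕ) :
    ∃ P : 𝕜[X], P.natDegree ≤ n ∧
      (fun u => φ u - P.eval u) =O[𝓝 0] fun u => u ^ (n + 1) := by
  obtain ⟨p, hp⟩ := h
  refine ⟨∑ l ∈ Finset.range (n + 1), C (p.coeff l) * X ^ l, ?_, ?_⟩
  · refine natDegree_sum_le_of_forall_le _ _ fun l hl => (natDegree_C_mul_X_pow_le _ _).trans ?_
    simp at hl; omega
  · have := hp.isBigO_sub_partialSum_pow (n + 1)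
    simp only [zero_add] at this
    refine (this.congr_left fun u => ?_).trans (IsBigO.of_bound' (.of_forall fun u => by simp))
    rw [FormalMultilinearSeries.partialSum, eval_finsetSum]
    congr 1
    refine Finset.sum_congr rfl fun l _ => ?_
    rw [FormalMultilinearSeries.apply_eq_pow_smul_coeff, smul_eq_mul, mul_comm]
    simp only [eval_mul, eval_C, eval_pow, eval_X]

variable {n : ℕ} {ν w : Fin (n + 1) → ℤ}

lemma sum_weights_eval (hw : ∀ l < n, ∑ i, w i * ν i ^ l = 0) {P : 𝕜[X]} (hP : P.natDegree ≤ n)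
    (z : 𝕜) :
    ∑ i, (w i : 𝕜) * P.eval (ν i * z) = P.coeff n * (∑ i, w i * ν i ^ n : ℤ) * z ^ n := by
  have h1 (i : Fin (n + 1)) : (w i : 𝕜) * P.eval (ν i * z) =
      ∑ l ∈ Finset.range (n + 1), P.coeff l * z ^ l * ((w i * ν i ^ l : ℤ) : 𝕜) := by
    rw [eval_eq_sum_range' (Nat.lt_succ_of_le hP), Finset.mul_sum]
    refine Finset.sum_congr rfl fun l _ => ?_
    push_cast; ring
  simp_rw [h1]
  rw [Finset.sum_comm, Finset.sum_range_succ, Finset.sum_eq_zero, zero_add]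
  · rw [← Finset.mul_sum]; push_cast; ring
  · intro l hl
    rw [← Finset.mul_sum, ← Int.cast_sum, hw l (Finset.mem_range.1 hl)]
    simp

/-- The weights act as an `n`-th divided difference, which kills polynomials of degree below `n`
around any base point. -/
lemma sum_weights_eval_add (hw : ∀ l < n, ∑ i, w i * ν i ^ l = 0) {P : 𝕜[X]}
    (hP : P.natDegree < n) (x : 𝕜) : ∑ i, (w i : 𝕜) * P.eval (x + ν i) = 0 := by
  have h2 : (P.comp (X + C x)).natDegree < n := by simpa [natDegree_comp] using hP
  have := sum_weights_eval hw h2.le (1 : 𝕜)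
  rw [coeff_eq_zero_of_natDegree_lt h2] at this
  simpa [add_comm] using this

lemma tendsto_intCast_mul_zero (a : ℤ) : Tendsto (fun z : 𝕜 => a * z) (𝓝 0) (𝓝 0) := by
  have : ContinuousAt (fun z : 𝕜 => a * z) 0 := by fun_prop
  simpa [ContinuousAt] using this

lemma sum_weights_isBigO (hw : ∀ l < n, ∑ i, w i * ν i ^ l = 0) {P : 𝕜[X]} (hP : P.natDegree ≤ n)
    {g : 𝕜 → 𝕜} (hg : (fun u => g u - P.eval u) =O[𝓝 0] fun u => u ^ (n + 1)) :
    (fun z => ∑ i, (w i : 𝕜) * g (ν i * z) - P.coeff n * (∑ i, w i * ν i ^ n : ℤ) * z ^ n)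
      =O[𝓝 0] fun z => z ^ (n + 1) := by
  have h (i : Fin (n + 1)) : (fun z => (w i : 𝕜) * (g (ν i * z) - P.eval (ν i * z)))
      =O[𝓝 0] fun z => z ^ (n + 1) := by
    refine IsBigO.const_mul_left ((hg.comp_tendsto (tendsto_intCast_mul_zero (ν i))).trans ?_) _
    simp only [Function.comp_def, mul_pow]
    exact (isBigO_refl _ _).const_mul_left _
  refine (IsBigO.sum (s := Finset.univ) fun i _ => h i).congr_left fun z => ?_
  rw [← sum_weights_eval hw hP]
  simp [mul_sub]

lemma inv_one_add_sub_isBigO (n : ℕ) :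
    (fun u : 𝕜 => (1 + u)⁻¹ - (∑ l ∈ Finset.range (n + 1), C ((-1) ^ l) * X ^ l : 𝕜[X]).eval u)
      =O[𝓝 0] fun u => u ^ (n + 1) := by
  have h0 : ∀ᶠ u : 𝕜 in 𝓝 0, 1 + u ≠ 0 :=
    (by fun_prop : ContinuousAt (fun u : 𝕜 => 1 + u) 0).eventually_ne (by simp)
  have h1 : Tendsto (fun u : 𝕜 => (-1) ^ (n + 1) * (1 + u)⁻¹) (𝓝 0) (𝓝 ((-1) ^ (n + 1) * (1 + 0)⁻¹)) :=
    ContinuousAt.tendsto (f := fun u : 𝕜 => (-1) ^ (n + 1) * (1 + u)⁻¹) (by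
      refine continuousAt_const.mul (ContinuousAt.inv₀ (by fun_prop) (by simp)))
  have h2 := (h1.isBigO_one 𝕜).mul (isBigO_refl (fun u : 𝕜 => u ^ (n + 1)) (𝓝 0))
  simp only [one_mul] at h2
  refine h2.congr' ?_ .rfl
  filter_upwards [h0] with u hu
  have h3 : (∑ l ∈ Finset.range (n + 1), C ((-1) ^ l) * X ^ l : 𝕜[X]).eval u =
      ∑ l ∈ Finset.range (n + 1), (-u) ^ l := by
    simp [eval_finsetSum, neg_pow u]
  have h4 := mul_neg_geom_sum (-u) (n + 1)
  rw [h3, eq_sub_iff_add_eq]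
  field_simp
  rw [sub_neg_eq_add] at h4
  rw [h4, neg_pow u]; ring

lemma analyticAt_inv_one_add_pow (l : ℕ) : AnalyticAt 𝕜 (fun u : 𝕜 => ((1 + u)⁻¹) ^ l) 0 := by
  refine AnalyticAt.pow (AnalyticAt.inv (by fun_prop) (by simp)) _

lemma isBigO_pow_pow_nhds_zero {a b : ℕ} (h : a ≤ b) :
    (fun z : 𝕜 => z ^ b) =O[𝓝 0] fun z => z ^ a := by
  have h1 : Tendsto (fun z : 𝕜 => z ^ (b - a)) (𝓝 0) (𝓝 (0 ^ (b - a))) :=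
    ContinuousAt.tendsto (f := fun z : 𝕜 => z ^ (b - a)) (by fun_prop)
  have := (isBigO_refl (fun z : 𝕜 => z ^ a) (𝓝 0)).mul (h1.isBigO_one 𝕜)
  simpa [← pow_add, Nat.add_sub_cancel' h] using this

/-- With `z = 1/y` one has `z / (1 + ν z) = 1 / (y + ν)`, so this is the asymptotics of the weighted
difference of `u * χ u` at the points `u = 1 / (y + ν i)` as `y` tends to infinity. -/
lemma sum_weights_comp_isBigO [CharZero 𝕜] (hw : ∀ l < n, ∑ i, w i * ν i ^ l = 0)
    {χ : 𝕜 → 𝕜} (hχ : AnalyticAt 𝕜 χ 0) :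
    (fun z : 𝕜 => ∑ i, (w i : 𝕜) * ((z * (1 + ν i * z)⁻¹) * χ (z * (1 + ν i * z)⁻¹)) -
      χ 0 * ((-1) ^ n * (∑ i, w i * ν i ^ n : ℤ)) * z ^ (n + 1))
      =O[𝓝 0] fun z : 𝕜 => z ^ (n + 2) := by
  obtain ⟨Q, hQ, hQχ⟩ := hχ.exists_polynomial_isBigO n
  have hQ0 : Q.coeff 0 = χ 0 := by
    have h0 := hQχ.eq_zero_imp.self_of_nhds (by simp)
    rw [coeff_zero_eq_eval_zero, sub_eq_zero.1 h0]
  have hh (i : Fin (n + 1)) : (fun z : 𝕜 => z * (1 + ν i * z)⁻¹) =O[𝓝 0] fun z => z := by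
    have h1 : Tendsto (fun z : 𝕜 => (1 + ν i * z)⁻¹) (𝓝 0) (𝓝 (1 + ν i * 0)⁻¹) :=
      ContinuousAt.tendsto (f := fun z : 𝕜 => (1 + ν i * z)⁻¹)
        (ContinuousAt.inv₀ (by fun_prop) (by simp))
    simpa using (isBigO_refl (fun z : 𝕜 => z) (𝓝 0)).mul (h1.isBigO_one 𝕜)
  have hh0 (i : Fin (n + 1)) : Tendsto (fun z : 𝕜 => z * (1 + ν i * z)⁻¹) (𝓝 0) (𝓝 0) :=
    (hh i).trans_tendsto tendsto_id
  have hrem (i : Fin (n + 1)) : (fun z : 𝕜 => (w i : 𝕜) * ((z * (1 + ν i * z)⁻¹) *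
      (χ (z * (1 + ν i * z)⁻¹) - Q.eval (z * (1 + ν i * z)⁻¹)))) =O[𝓝 0] fun z : 𝕜 => z ^ (n + 2) := by
    refine IsBigO.const_mul_left ?_ _
    refine ((hh i).mul ((hQχ.comp_tendsto (hh0 i)).trans ((hh i).pow (n + 1)))).congr_right ?_
    intro z; ring
  -- The weights kill the expansion of `(1 + ν z)⁻¹ ^ (l + 1)` below order `n`, so the `l`-th Taylor
  -- term has order at least `n + l + 1`. Only `l = 0` reaches order `n + 1`, with the sign `(-1) ^
  -- n` of the geometric series.
  have hterm (l : ℕ) : (fun z : 𝕜 => Q.coeff l * ∑ i, (w i : 𝕜) * (z * (1 + ν i * z)⁻¹) ^ (l + 1) -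
      if l = 0 then χ 0 * ((-1) ^ n * (∑ i, w i * ν i ^ n : ℤ)) * z ^ (n + 1) else 0)
      =O[𝓝 0] fun z : 𝕜 => z ^ (n + 2) := by
    rcases Nat.eq_zero_or_pos l with rfl | hl
    · have h := sum_weights_isBigO hw (P := ∑ l ∈ Finset.range (n + 1), C ((-1) ^ l) * X ^ l)
        (natDegree_sum_le_of_forall_le _ _ fun l hl => (natDegree_C_mul_X_pow_le _ _).trans
          (by simp at hl; omega)) (inv_one_add_sub_isBigO (𝕜 := 𝕜) n)
      have h' := ((isBigO_refl (fun z : 𝕜 => z) (𝓝 0)).mul h).const_mul_left (χ 0)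
      refine (h'.congr_left fun z => ?_).congr_right fun z => by ring
      have : (∑ l ∈ Finset.range (n + 1), C ((-1) ^ l) * X ^ l : 𝕜[X]).coeff n = (-1) ^ n := by
        simp only [finsetSum_coeff, coeff_C_mul, coeff_X_pow]; simp
      simp only [this, hQ0, zero_add, pow_one, if_true, mul_sub, Finset.mul_sum]
      congr 1
      · exact Finset.sum_congr rfl fun i _ => by ring
      · ring
    · obtain ⟨P, hP, hPO⟩ := (analyticAt_inv_one_add_pow (𝕜 := 𝕜) (l + 1)).exists_polynomial_isBigO n
      have h := sum_weights_isBigO hw hP hPO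
      have h2 : (fun z : 𝕜 => ∑ i, (w i : 𝕜) * ((1 + ν i * z)⁻¹) ^ (l + 1)) =O[𝓝 0]
          fun z => z ^ n := by
        have h3 := (h.trans (isBigO_pow_pow_nhds_zero n.le_succ)).add
          ((isBigO_refl (fun z : 𝕜 => z ^ n) (𝓝 0)).const_mul_left
            (P.coeff n * (∑ i, w i * ν i ^ n : ℤ)))
        simpa using h3
      have h4 : (fun z : 𝕜 => z ^ (l + 1)) =O[𝓝 0] fun z => z ^ 2 :=
        isBigO_pow_pow_nhds_zero (by omega)
      simp only [hl.ne', if_false, sub_zero]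
      refine IsBigO.const_mul_left ?_ _
      refine ((h4.mul h2).congr_left fun z => ?_).congr_right fun z => by ring
      simp only [mul_pow, Finset.mul_sum]
      exact Finset.sum_congr rfl fun i _ => by ring
  have hsum := (IsBigO.sum (s := Finset.univ) fun i _ => hrem i).add
    (IsBigO.sum (s := Finset.range (n + 1)) fun l _ => hterm l)
  refine hsum.congr_left fun z => ?_
  simp only [Finset.sum_apply, Finset.sum_sub_distrib, mul_sub, Finset.sum_ite_eq', Finset.mem_range,
    Nat.succ_pos, if_true]
  have : ∑ l ∈ Finset.range (n + 1), Q.coeff l * ∑ i, (w i : 𝕜) * (z * (1 + ν i * z)⁻¹) ^ (l + 1) =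
      ∑ i, (w i : 𝕜) * ((z * (1 + ν i * z)⁻¹) * Q.eval (z * (1 + ν i * z)⁻¹)) := by
    simp_rw [Finset.mul_sum]
    rw [Finset.sum_comm]
    refine Finset.sum_congr rfl fun i _ => ?_
    rw [eval_eq_sum_range' (Nat.lt_succ_of_le hQ), Finset.mul_sum, Finset.mul_sum]
    exact Finset.sum_congr rfl fun l _ => by ring
  rw [this]; ring

lemma eventually_sum_weights_comp_ne_zero [CharZero 𝕜] (hw : ∀ l < n, ∑ i, w i * ν i ^ l = 0)
    (hw' : ∑ i, w i * ν i ^ n ≠ 0) {χ : 𝕜 → 𝕜} (hχ : AnalyticAt 𝕜 χ 0) (hχ0 : χ 0 ≠ 0) :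
    ∀ᶠ z : 𝕜 in 𝓝[≠] 0,
      ∑ i, (w i : 𝕜) * ((z * (1 + ν i * z)⁻¹) * χ (z * (1 + ν i * z)⁻¹)) ≠ 0 := by
  set c : 𝕜 := χ 0 * ((-1) ^ n * (∑ i, w i * ν i ^ n : ℤ)) with hc
  have hc0 : c ≠ 0 := mul_ne_zero hχ0 (mul_ne_zero (pow_ne_zero _ (by simp)) (by exact_mod_cast hw'))
  obtain ⟨A, hA⟩ := (sum_weights_comp_isBigO hw hχ).bound
  have hsmall : ∀ᶠ z : 𝕜 in 𝓝 0, A * ‖z‖ < ‖c‖ := by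
    have : ContinuousAt (fun z : 𝕜 => A * ‖z‖) 0 := by fun_prop
    exact this.eventually_lt continuousAt_const (by simpa using hc0)
  filter_upwards [nhdsWithin_le_nhds hA, nhdsWithin_le_nhds hsmall, self_mem_nhdsWithin]
    with z h1 h2 hz h3
  rw [h3, zero_sub, norm_neg, norm_mul, norm_pow, norm_pow, pow_succ _ (n + 1)] at h1
  have hz' : 0 < ‖z‖ ^ (n + 1) := pow_pos (norm_pos_iff.2 hz) _
  nlinarith

lemma tendsto_sum_weights_comp {χ : 𝕜 → 𝕜} (hχ : ContinuousAt χ 0) :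
    Tendsto (fun z : 𝕜 => ∑ i, (w i : 𝕜) * ((z * (1 + ν i * z)⁻¹) * χ (z * (1 + ν i * z)⁻¹)))
      (𝓝 0) (𝓝 0) := by
  have h (i : Fin (n + 1)) : ContinuousAt (fun z : 𝕜 => z * (1 + ν i * z)⁻¹) 0 :=
    continuousAt_id.mul (ContinuousAt.inv₀ (by fun_prop) (by simp))
  have h' : ContinuousAt (fun z : 𝕜 => ∑ i, (w i : 𝕜) * ((z * (1 + ν i * z)⁻¹) *
      χ (z * (1 + ν i * z)⁻¹))) 0 := by
    refine tendsto_finsetSum _ fun i _ => ?_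
    refine continuousAt_const.mul ((h i).mul (ContinuousAt.comp (f := fun z : 𝕜 =>
      z * (1 + ν i * z)⁻¹) (g := χ) (by simpa using hχ) (h i)))
  simpa [ContinuousAt] using h'

/-- Subtract the Taylor polynomial of degree at most `E`. The remainder is not identically zero, so
it has a finite order of vanishing `e`, and being `O(u ^ (E + 1))` it has `e > E`. -/
lemma AnalyticAt.exists_eventuallyEq_polynomial_add {φ : 𝕜 → 𝕜} (hφ : AnalyticAt 𝕜 φ 0) {E : ℕ}
    (hE : ¬ ∃ P : 𝕜[X], P.natDegree ≤ E ∧ ∀ᶠ u in 𝓝 0, φ u = P.eval u) :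
    ∃ (P : 𝕜[X]) (e : ℕ) (χ : 𝕜 → 𝕜), P.natDegree ≤ E ∧ E < e ∧ AnalyticAt 𝕜 χ 0 ∧ χ 0 ≠ 0 ∧
      ∀ᶠ u in 𝓝 0, φ u = P.eval u + u ^ e * χ u := by
  obtain ⟨P, hP, hPO⟩ := hφ.exists_polynomial_isBigO E
  have han : AnalyticAt 𝕜 (fun u => φ u - P.eval u) 0 :=
    hφ.sub (analyticAt_id.aeval_polynomial P)
  have hne : ¬ ∀ᶠ u in 𝓝 0, φ u - P.eval u = 0 :=
    fun h => hE ⟨P, hP, h.mono fun u hu => sub_eq_zero.1 hu⟩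
  obtain ⟨e, χ, hχ, hχ0, heq⟩ := han.exists_eventuallyEq_pow_smul_nonzero_iff.2 hne
  simp only [sub_zero, smul_eq_mul] at heq
  refine ⟨P, e, χ, hP, ?_, hχ, hχ0, heq.mono fun u hu => by rw [← hu]; ring⟩
  by_contra! he
  obtain ⟨A, hA⟩ := hPO.bound
  have hlim : Tendsto (fun u : 𝕜 => A * ‖u‖ - ‖χ u‖) (𝓝 0) (𝓝 (A * ‖(0 : 𝕜)‖ - ‖χ 0‖)) := by
    have h1 : ContinuousAt (fun u : 𝕜 => A * ‖u‖) 0 := by fun_prop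
    exact h1.sub hχ.continuousAt.norm
  have hneg : ∀ᶠ u : 𝕜 in 𝓝 0, A * ‖u‖ - ‖χ u‖ < 0 :=
    hlim.eventually_lt_const (by simpa using hχ0)
  have hsmall : ∀ᶠ u : 𝕜 in 𝓝 0, ‖u‖ < 1 :=
    (continuous_norm.continuousAt (x := (0 : 𝕜))).eventually_lt continuousAt_const (by simp)
  have hA0 : ∀ᶠ u : 𝕜 in 𝓝[≠] 0, False := by
    filter_upwards [nhdsWithin_le_nhds hA, nhdsWithin_le_nhds hneg, nhdsWithin_le_nhds heq,
      nhdsWithin_le_nhds hsmall, self_mem_nhdsWithin] with u h1 h2 h3 h4 hu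
    have hu' : 0 < ‖u‖ := norm_pos_iff.2 hu
    rw [h3, norm_mul, norm_pow, norm_pow] at h1
    have hue : 0 < ‖u‖ ^ e := pow_pos hu' e
    have hAn : 0 ≤ A := by
      by_contra! hA
      nlinarith [pow_pos hu' (E + 1), norm_nonneg (χ u), mul_nonneg hue.le (norm_nonneg (χ u))]
    have h5 : ‖u‖ ^ (E + 1) ≤ ‖u‖ ^ e * ‖u‖ := by
      rw [← pow_succ]; exact pow_le_pow_of_le_one hu'.le h4.le (by omega)
    nlinarith [mul_le_mul_of_nonneg_left h5 hAn]
  exact (NormedField.nhdsNE_neBot (0 : 𝕜)).ne (by simpa using hA0)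

end Gap

/-! ### Integral values of an analytic function at large integral points -/

section Discrete

variable {O 𝕜 : Type*} [CommRing O] [NontriviallyNormedField 𝕜] [Algebra O 𝕜]

variable (O 𝕜) in
/-- The filter of elements of `O` whose image in `𝕜` has large norm. -/
def largeFilter : Filter O := comap (fun x : O => ‖algebraMap O 𝕜 x‖) atTop

lemma tendsto_largeFilter : Tendsto (fun x => (algebraMap O 𝕜 x)⁻¹) (largeFilter O 𝕜) (𝓝[≠] 0) :=
  tendsto_inv₀_cobounded'.comp (tendsto_norm_atTop_iff_cobounded.1 tendsto_comap)

/-- Write `φ u = P u + u ^ e * χ u` with `e > E` and multiply the supposed integral values by `m ^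
(e - 1 - E)`. The part from `P` becomes a polynomial in `m` of degree at most `e - 1`, which the
weights kill; the rest is `b * m⁻¹ * χ m⁻¹`, whose weighted sum is nonzero but tends to zero. An
integral element cannot be nonzero of norm less than `1`. -/
theorem eventually_not_forall_exists_eq [CharZero 𝕜]
    (hO : ∀ a : O, algebraMap O 𝕜 a ≠ 0 → 1 ≤ ‖algebraMap O 𝕜 a‖)
    {b : O} (hb : algebraMap O 𝕜 b ≠ 0) {φ : 𝕜 → 𝕜} (hφ : AnalyticAt 𝕜 φ 0) {E : ℕ}
    (hE : ¬ ∃ P : 𝕜[X], P.natDegree ≤ E ∧ ∀ᶠ u in 𝓝 0, φ u = P.eval u) :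
    ∃ n₀, ∀ n ≥ n₀, ∀ ν : Fin (n + 1) → ℤ, Function.Injective ν → ∀ᶠ x in largeFilter O 𝕜,
      ¬ ∀ i, ∃ a : O, algebraMap O 𝕜 a = algebraMap O 𝕜 b * algebraMap O 𝕜 (x + ν i) ^ E *
        φ (algebraMap O 𝕜 (x + ν i))⁻¹ := by
  obtain ⟨P, e, χ, hP, he, hχ, hχ0, heq⟩ := hφ.exists_eventuallyEq_polynomial_add hE
  -- The condition `e ≤ n` ensures that polynomials of degree at most `e - 1` are annihilated.
  refine ⟨e, fun n hn ν hν => ?_⟩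
  obtain ⟨w, hw, hw'⟩ := exists_int_weights hν
  have hh0 (i : Fin (n + 1)) : Tendsto (fun z : 𝕜 => z * (1 + ν i * z)⁻¹) (𝓝 0) (𝓝 0) := by
    have : ContinuousAt (fun z : 𝕜 => z * (1 + ν i * z)⁻¹) 0 :=
      continuousAt_id.mul (ContinuousAt.inv₀ (by fun_prop) (by simp))
    simpa [ContinuousAt] using this
  have hne : ∀ᶠ z : 𝕜 in 𝓝 0, ∀ i, 1 + ν i * z ≠ 0 := by
    refine eventually_all.2 fun i => ?_
    exact ContinuousAt.eventually_ne (g := fun z : 𝕜 => 1 + ν i * z) (by fun_prop) (by simp)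
  have hev : ∀ᶠ z : 𝕜 in 𝓝 0, ∀ i, φ (z * (1 + ν i * z)⁻¹) = P.eval (z * (1 + ν i * z)⁻¹) +
      (z * (1 + ν i * z)⁻¹) ^ e * χ (z * (1 + ν i * z)⁻¹) :=
    eventually_all.2 fun i => (hh0 i).eventually heq
  have hsmall : ∀ᶠ z : 𝕜 in 𝓝 0, ‖algebraMap O 𝕜 b *
      ∑ i, (w i : 𝕜) * ((z * (1 + ν i * z)⁻¹) * χ (z * (1 + ν i * z)⁻¹))‖ < 1 := by
    have := ((tendsto_sum_weights_comp (w := w) (ν := ν) hχ.continuousAt).const_mul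
      (algebraMap O 𝕜 b)).norm
    rw [mul_zero, norm_zero] at this
    exact this.eventually_lt_const one_pos
  have hnz := eventually_sum_weights_comp_ne_zero hw hw' hχ hχ0
  filter_upwards [tendsto_largeFilter.eventually (nhdsWithin_le_nhds hne),
    tendsto_largeFilter.eventually (nhdsWithin_le_nhds hev),
    tendsto_largeFilter.eventually (nhdsWithin_le_nhds hsmall),
    tendsto_largeFilter.eventually hnz,
    tendsto_largeFilter.eventually self_mem_nhdsWithin] with x h1 h2 h3 h4 h5 hcon
  choose a ha using hcon
  set y := algebraMap O 𝕜 x with hy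
  have hy0 : y ≠ 0 := fun h => h5 (by simp [h])
  have hm (i : Fin (n + 1)) : algebraMap O 𝕜 (x + ν i) = y + ν i := by simp [hy]
  have hm0 (i : Fin (n + 1)) : y + ν i ≠ 0 := by
    have := h1 i
    contrapose! this
    field_simp
    simpa using this
  have hz (i : Fin (n + 1)) : y⁻¹ * (1 + ν i * y⁻¹)⁻¹ = (y + ν i)⁻¹ := by
    rw [← mul_inv]; congr 1; field_simp
  simp only [hz] at h2 h3 h4
  have hrev : ∑ i, (w i : 𝕜) * ((y + ν i) ^ (e - 1) * P.eval (y + ν i)⁻¹) = 0 := by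
    have h6 := sum_weights_eval_add hw
      (P := ∑ l ∈ Finset.range (E + 1), C (P.coeff l) * X ^ (e - 1 - l)) (n := n)
      (lt_of_le_of_lt (natDegree_sum_le_of_forall_le _ (n := e - 1) _ fun l hl =>
        (natDegree_C_mul_X_pow_le _ _).trans (by omega)) (by omega)) y
    rw [← h6]
    refine Finset.sum_congr rfl fun i _ => ?_
    congr 1
    rw [eval_eq_sum_range' (Nat.lt_succ_of_le hP), eval_finsetSum, Finset.mul_sum]
    refine Finset.sum_congr rfl fun l hl => ?_
    have : e - 1 = (e - 1 - l) + l := by simp at hl; omega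
    conv_lhs => rw [this]
    rw [pow_add, inv_pow]
    have := pow_ne_zero l (hm0 i)
    simp only [eval_mul, eval_C, eval_pow, eval_X]
    field_simp
  have key : algebraMap O 𝕜 (∑ i, (w i : O) * ((x + ν i) ^ (e - 1 - E) * a i)) =
      algebraMap O 𝕜 b * ∑ i, (w i : 𝕜) * ((y + ν i)⁻¹ * χ (y + ν i)⁻¹) := by
    have h7 (i : Fin (n + 1)) : (w i : 𝕜) * ((y + ν i) ^ (e - 1 - E) * algebraMap O 𝕜 (a i)) =
        algebraMap O 𝕜 b * ((w i : 𝕜) * ((y + ν i) ^ (e - 1) * P.eval (y + ν i)⁻¹)) +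
        algebraMap O 𝕜 b * ((w i : 𝕜) * ((y + ν i)⁻¹ * χ (y + ν i)⁻¹)) := by
      rw [ha i, hm, h2 i]
      have h8 : (y + ν i) ^ (e - 1) = (y + ν i) ^ (e - 1 - E) * (y + ν i) ^ E := by
        rw [← pow_add]; congr 1; omega
      have h9 : (y + ν i) ^ (e - 1) * (y + ν i)⁻¹ ^ e = (y + ν i)⁻¹ := by
        obtain ⟨e', rfl⟩ : ∃ e', e = e' + 1 := ⟨e - 1, by omega⟩
        have := hm0 i
        rw [Nat.add_sub_cancel, pow_succ, inv_pow]
        field_simp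
      generalize P.eval (y + ν i : 𝕜)⁻¹ = p
      generalize χ (y + ν i : 𝕜)⁻¹ = q
      generalize (y + ν i : 𝕜)⁻¹ ^ e = r at h9 ⊢
      linear_combination (-(w i : 𝕜) * algebraMap O 𝕜 b * p - w i * algebraMap O 𝕜 b * q * r) * h8 +
        w i * algebraMap O 𝕜 b * q * h9
    rw [map_sum]
    simp only [map_mul, map_pow, map_intCast, map_add, ← hy]
    rw [Finset.sum_congr rfl fun i _ => h7 i, Finset.sum_add_distrib, ← Finset.mul_sum, hrev,
      ← Finset.mul_sum]
    ring
  have h10 := hO (∑ i, (w i : O) * ((x + ν i) ^ (e - 1 - E) * a i))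
    (by rw [key]; exact mul_ne_zero hb h4)
  rw [key] at h10
  exact absurd h3 (not_lt.2 h10)

end Discrete

end

/-! ### Analytic dependence of simple roots on a parameter -/

section

open Polynomial Filter Topology Asymptotics

section AnalyticRoots

variable {𝕜 : Type*} [NontriviallyNormedField 𝕜]

lemma analyticAt_evalEval (F : 𝕜[X][X]) (p : 𝕜 × 𝕜) :
    AnalyticAt 𝕜 (fun q : 𝕜 × 𝕜 => (F.map (evalRingHom q.1)).eval q.2) p := by
  have h (q : 𝕜 × 𝕜) : (F.map (evalRingHom q.1)).eval q.2 =
      ∑ i ∈ Finset.range (F.natDegree + 1), aeval q.1 (F.coeff i) * q.2 ^ i := by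
    rw [eval_eq_sum_range' (Nat.lt_succ_of_le natDegree_map_le)]
    simp [coe_aeval_eq_eval]
  simp_rw [h]
  refine Finset.analyticAt_fun_sum _ fun i _ => ?_
  exact (analyticAt_fst.aeval_polynomial _).mul (analyticAt_snd.pow _)

theorem exists_analyticAt_root [CompleteSpace 𝕜] (F : 𝕜[X][X]) {r : 𝕜}
    (hr : (F.map (evalRingHom 0)).IsRoot r)
    (hr' : (F.map (evalRingHom 0)).derivative.eval r ≠ 0) :
    ∃ y : 𝕜 → 𝕜, AnalyticAt 𝕜 y 0 ∧ y 0 = r ∧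
      ∀ᶠ u in 𝓝 0, (F.map (evalRingHom u)).IsRoot (y u) := by
  set f : 𝕜 × 𝕜 → 𝕜 := fun q => (F.map (evalRingHom q.1)).eval q.2 with hf
  have hfa := analyticAt_evalEval F (0, r)
  set L := fderiv 𝕜 f (0, r)
  have hL : HasStrictFDerivAt f L (0, r) := hfa.hasStrictFDerivAt
  set c := (F.map (evalRingHom 0)).derivative.eval r
  have hLc : L (0, 1) = c := by
    have h1 : HasFDerivAt (fun y : 𝕜 => ((0 : 𝕜), y)) (ContinuousLinearMap.inr 𝕜 𝕜 𝕜) r :=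
      hasFDerivAt_prodMk_right _ _
    have h2 := (HasFDerivAt.comp (g := f) (f := fun y : 𝕜 => ((0 : 𝕜), y)) r hL.hasFDerivAt
      h1).hasDerivAt
    exact h2.unique ((F.map (evalRingHom 0)).hasDerivAt r)
  -- The derivative of `(u, y) ↦ (u, F(u, y))` at `(0, r)` is triangular with diagonal entries `1`
  -- and `c`, hence invertible. The root is read off from the inverse map along `(u, 0)`.
  let i : (𝕜 × 𝕜) ≃L[𝕜] (𝕜 × 𝕜) := (ContinuousLinearEquiv.refl 𝕜 𝕜).skewProd
    (ContinuousLinearEquiv.unitsEquivAut 𝕜 (Units.mk0 c hr')) (L.comp (.inl 𝕜 𝕜 𝕜))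
  have hi : (i : 𝕜 × 𝕜 →L[𝕜] 𝕜 × 𝕜) = (ContinuousLinearMap.fst 𝕜 𝕜 𝕜).prod L := by
    ext <;> simp [i, hLc]
    exact L.map_zero
  have hΨ : HasStrictFDerivAt (fun q : 𝕜 × 𝕜 => (q.1, f q)) (i : 𝕜 × 𝕜 →L[𝕜] 𝕜 × 𝕜) (0, r) := by
    rw [hi]
    exact hasStrictFDerivAt_fst.prodMk hL
  have hf0 : f (0, r) = 0 := hr
  set R := hΨ.toOpenPartialHomeomorph _
  have hR : (0, r) ∈ R.source := HasStrictFDerivAt.mem_toOpenPartialHomeomorph_source _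
  have hRcoe (q) : R q = (q.1, f q) := rfl
  have hsymm : AnalyticAt 𝕜 R.symm (0, 0) := by
    have := R.analyticAt_symm' (i := i) hR (analyticAt_fst.prod hfa) hΨ.hasFDerivAt.fderiv
    simpa [hRcoe, hf0] using this
  have hcont : ContinuousAt (fun u : 𝕜 => (u, (0 : 𝕜))) 0 := by fun_prop
  refine ⟨fun u => (R.symm (u, 0)).2, ?_, ?_, ?_⟩
  · exact analyticAt_snd.comp (AnalyticAt.comp (f := fun u : 𝕜 => (u, (0 : 𝕜))) hsymm
      (analyticAt_id.prod analyticAt_const))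
  · have := R.left_inv hR
    rw [hRcoe, hf0] at this
    simp [this]
  · have ht : R.target ∈ 𝓝 ((0 : 𝕜), (0 : 𝕜)) := by
      have := R.open_target.mem_nhds (R.map_source hR)
      simpa [hRcoe, hf0] using this
    filter_upwards [hcont.eventually ht] with u hu
    have h3 := R.right_inv hu
    rw [hRcoe] at h3
    have h4 : (R.symm (u, 0)).1 = u := congr_arg Prod.fst h3
    have h5 : f (R.symm (u, 0)) = 0 := congr_arg Prod.snd h3
    have h6 : (F.map (evalRingHom u)).eval (R.symm (u, 0)).2 = 0 := by simpa only [hf, h4] using h5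
    exact h6

/-- If `F(0, Y)` has simple roots, then near `u = 0` the polynomial `F(u, Y)` is the product of
linear factors that depend analytically on `u`. -/
theorem exists_analyticAt_factorization [CompleteSpace 𝕜] {F : 𝕜[X][X]} (hF : F.Monic)
    (hsplit : (F.map (evalRingHom 0)).Splits) (hsep : (F.map (evalRingHom 0)).Separable) :
    ∃ y : Fin F.natDegree → 𝕜 → 𝕜, (∀ i, AnalyticAt 𝕜 (y i) 0) ∧
      ∀ᶠ u in 𝓝 0, F.map (evalRingHom u) = ∏ i, (X - C (y i u)) := by
  classical
  set p := F.map (evalRingHom 0)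
  have hp0 : p ≠ 0 := (hF.map _).ne_zero
  have hcard : p.roots.toFinset.card = F.natDegree := by
    rw [Multiset.toFinset_card_of_nodup (nodup_roots hsep), ← hsplit.natDegree_eq_card_roots,
      hF.natDegree_map]
  let e := p.roots.toFinset.equivFinOfCardEq hcard
  have hroot (i) : p.IsRoot (e.symm i : 𝕜) := by
    have := (e.symm i).2
    rw [Multiset.mem_toFinset, mem_roots hp0] at this
    exact this
  choose y hya hy0 hy using fun i => exists_analyticAt_root F (hroot i)
    (by
      have := hsep.aeval_derivative_ne_zero (x := (e.symm i : 𝕜)) (by simpa using hroot i)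
      rw [coe_aeval_eq_eval] at this
      exact this)
  refine ⟨y, hya, ?_⟩
  have hdist : ∀ᶠ u in 𝓝 0, ∀ i j, i ≠ j → y i u ≠ y j u := by
    refine eventually_all.2 fun i => eventually_all.2 fun j => eventually_imp_distrib_left.2 ?_
    intro hij
    have : y i 0 ≠ y j 0 := by
      rw [hy0, hy0]
      exact fun h => hij (e.symm.injective (Subtype.ext h))
    exact (((hya i).continuousAt.sub (hya j).continuousAt).eventually_ne
      (sub_ne_zero.2 this)).mono fun u => sub_ne_zero.1
  filter_upwards [hdist, eventually_all.2 hy] with u h1 h2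
  have hm : (F.map (evalRingHom u)).Monic := hF.map _
  have hinj : Function.Injective fun i => y i u := fun i j h => by
    by_contra hij; exact h1 i j hij h
  refine eq_of_monic_of_dvd_of_natDegree_le (monic_prod_of_monic _ _ fun i _ => monic_X_sub_C _) hm
    ?_ ?_
  · refine Finset.prod_dvd_of_coprime (fun i _ j _ hij => ?_) fun i _ => ?_
    · exact isCoprime_X_sub_C_of_isUnit_sub (sub_ne_zero.2 (h1 i j hij)).isUnit
    · exact dvd_iff_isRoot.2 (h2 i)
  · rw [hF.natDegree_map, natDegree_prod_of_monic _ _ fun i _ => monic_X_sub_C _]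
    simp

end AnalyticRoots

end

/-! ### Irreducible specialisations near infinity -/

section

open Polynomial Filter Topology Asymptotics

section Hilbert

variable {O k 𝕜 : Type*} [CommRing O] [IsDomain O] [Field k] [Algebra O k]
  [IsFractionRing O k]

/-- Denominators of the coefficients of the monic factors of `f(1/m, Y)`. -/
lemma exists_denominator_of_dvd_eval_inv [IsIntegrallyClosed O] {f : k[X][X]} (hf : f.Monic) :
    ∃ b : O, b ≠ 0 ∧ ∃ E : ℕ, ∀ m : O, m ≠ 0 → ∀ g : k[X], g.Monic →
      g ∣ f.map (evalRingHom (algebraMap O k m)⁻¹) →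
      ∀ j, ∃ a : O, algebraMap O k a = algebraMap O k b * algebraMap O k m ^ E * g.coeff j := by
  classical
  set d := f.natDegree with hd
  set D := (Finset.range (d + 1)).sup fun i => (f.coeff i).natDegree with hD
  obtain ⟨⟨b, hb⟩, hbi⟩ := IsLocalization.exist_integer_multiples_of_finset (nonZeroDivisors O)
    ((Finset.range (d + 1) ×ˢ Finset.range (D + 1)).image fun q => (f.coeff q.1).coeff q.2)
  have hb0 : b ≠ 0 := nonZeroDivisors.ne_zero hb
  have hbi' (i l : ℕ) (hi : i ≤ d) (hl : l ≤ D) :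
      ∃ a : O, algebraMap O k a = algebraMap O k b * (f.coeff i).coeff l := by
    obtain ⟨a, ha⟩ := hbi _ (Finset.mem_image.2 ⟨(i, l), by simp [hi, hl], rfl⟩)
    exact ⟨a, by rw [ha, Algebra.smul_def]⟩
  -- The element `c = b * m ^ D` clears the denominators of `f(1/m, Y)`. Scaling the roots by `c`
  -- makes this polynomial monic over `O`, and Gauss's lemma makes its monic factors integral.
  -- Undoing the scaling costs at most `c ^ d = b ^ d * m ^ (D * d)`.
  refine ⟨b ^ d, pow_ne_zero _ hb0, D * d, fun m hm g hg hgf j => ?_⟩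
  set μ := algebraMap O k m with hμ
  have hμ0 : μ ≠ 0 := by simpa [hμ] using hm
  set c : O := b * m ^ D with hc
  set p := f.map (evalRingHom μ⁻¹) with hp
  have hpm : p.Monic := hf.map _
  have hpd : p.natDegree = d := hf.natDegree_map _
  have hcoef (i : ℕ) (hi : i ≤ d) : ∃ a : O, algebraMap O k a = algebraMap O k c * p.coeff i := by
    choose! a ha using fun l => hbi' i l hi
    refine ⟨∑ l ∈ Finset.range (D + 1), a l * m ^ (D - l), ?_⟩
    have hdeg : (f.coeff i).natDegree < D + 1 := Nat.lt_succ_of_le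
      (Finset.le_sup (f := fun i => (f.coeff i).natDegree) (Finset.mem_range.2 (by omega)))
    rw [hp, coeff_map, coe_evalRingHom, eval_eq_sum_range' hdeg, Finset.mul_sum, map_sum]
    refine Finset.sum_congr rfl fun l hl => ?_
    have hl' : l ≤ D := by simpa [Nat.lt_succ_iff] using hl
    rw [map_mul, map_pow, ha l hl', hc, map_mul, map_pow, ← hμ]
    have : μ ^ D = μ ^ (D - l) * μ ^ l := by rw [← pow_add]; congr 1; omega
    rw [this, inv_pow]
    field_simp
  have hlift : p.scaleRoots (algebraMap O k c) ∈ lifts (algebraMap O k) := by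
    rw [lifts_iff_coeff_lifts]
    intro i
    rw [coeff_scaleRoots, hpd]
    rcases lt_trichotomy i d with hi | hi | hi
    · obtain ⟨a, ha⟩ := hcoef i hi.le
      refine ⟨a * c ^ (d - i - 1), ?_⟩
      have : d - i = (d - i - 1) + 1 := by omega
      rw [map_mul, ha, map_pow, this, pow_succ, Nat.add_sub_cancel]; ring
    · refine ⟨1, ?_⟩
      rw [hi, Nat.sub_self, pow_zero, mul_one, map_one, ← hpd, hpm.coeff_natDegree]
    · exact ⟨0, by rw [coeff_eq_zero_of_natDegree_lt (by omega)]; simp⟩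
  obtain ⟨q, hq, -, hqm⟩ := lifts_and_natDegree_eq_and_monic hlift
    ((monic_scaleRoots_iff _).2 hpm)
  have hdvd : g.scaleRoots (algebraMap O k c) ∣ q.map (algebraMap O k) := by
    rw [hq]; exact scaleRoots_dvd _ _ hgf
  obtain ⟨g', hg'⟩ := IsIntegrallyClosed.eq_map_mul_C_of_dvd k hqm hdvd
  rw [((monic_scaleRoots_iff _).2 hg).leadingCoeff, C_1, mul_one] at hg'
  rcases lt_or_ge g.natDegree j with hj | hj
  · exact ⟨0, by rw [coeff_eq_zero_of_natDegree_lt hj]; simp⟩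
  have hgd : g.natDegree ≤ d := hpd ▸ natDegree_le_of_dvd hgf hpm.ne_zero
  refine ⟨g'.coeff j * c ^ (d - (g.natDegree - j)), ?_⟩
  have h1 : algebraMap O k (g'.coeff j) = g.coeff j * algebraMap O k c ^ (g.natDegree - j) := by
    rw [← coeff_map, hg', coeff_scaleRoots]
  have h2 : algebraMap O k (b ^ d) * μ ^ (D * d) = algebraMap O k c ^ d := by
    rw [hc, map_mul, map_pow, map_pow, mul_pow, ← pow_mul]
  have h3 : algebraMap O k c ^ d = algebraMap O k c ^ (g.natDegree - j) *
      algebraMap O k c ^ (d - (g.natDegree - j)) := by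
    rw [← pow_add]; congr 1; omega
  rw [map_mul, h1, h2, h3, map_pow]; ring

lemma exists_map_eq_of_eval_mem {k 𝕜 : Type*} [Field k] [Field 𝕜] [Algebra k 𝕜] {n : ℕ}
    {t : Fin (n + 1) → k} (ht : Function.Injective t) {P : 𝕜[X]} (hP : P.natDegree ≤ n)
    (h : ∀ i, ∃ a : k, algebraMap k 𝕜 a = P.eval (algebraMap k 𝕜 (t i))) :
    ∃ Q : k[X], Q.map (algebraMap k 𝕜) = P := by
  choose a ha using h
  refine ⟨Lagrange.interpolate Finset.univ t a, ?_⟩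
  have hinj : Set.InjOn t (Finset.univ : Finset (Fin (n + 1))) := ht.injOn
  refine eq_of_degrees_lt_of_eval_index_eq (v := fun i => algebraMap k 𝕜 (t i)) Finset.univ
    (fun i _ j _ hij => ht ((algebraMap k 𝕜).injective hij)) ?_ ?_ fun i _ => ?_
  · rw [degree_map]; exact Lagrange.degree_interpolate_lt _ hinj
  · refine lt_of_le_of_lt (natDegree_le_iff_degree_le.1 hP) ?_
    simp only [Finset.card_univ, Fintype.card_fin]
    exact_mod_cast n.lt_succ_self
  · rw [eval_map_algebraMap, aeval_algebraMap_apply, coe_aeval_eq_eval,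
      Lagrange.eval_interpolate_at_node _ hinj (Finset.mem_univ i), ha]

lemma analyticAt_coeff_prod_X_sub_C {𝕜 ι : Type*} [NontriviallyNormedField 𝕜] {y : ι → 𝕜 → 𝕜}
    (hy : ∀ i, AnalyticAt 𝕜 (y i) 0) (I : Finset ι) (j : ℕ) :
    AnalyticAt 𝕜 (fun u => (∏ i ∈ I, (X - C (y i u))).coeff j) 0 := by
  classical
  induction I using Finset.induction_on generalizing j with
  | empty => simpa using analyticAt_const
  | insert i I hi ih =>
    simp only [Finset.prod_insert hi, coeff_mul]
    refine Finset.analyticAt_fun_sum _ fun q _ => AnalyticAt.mul ?_ (ih _)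
    simp only [coeff_sub, coeff_C]
    split_ifs
    · exact analyticAt_const.sub (hy i)
    · exact analyticAt_const.sub analyticAt_const

lemma exists_finset_of_dvd_prod_X_sub_C {k ι : Type*} [Field k] {s : Finset ι} {y : ι → k}
    {g : k[X]} (hg : g.Monic) (h : g ∣ ∏ i ∈ s, (X - C (y i))) :
    ∃ I ⊆ s, g = ∏ i ∈ I, (X - C (y i)) := by
  classical
  obtain ⟨q, hq⟩ := h
  obtain ⟨t, u, b, c, htu, -, hbc, hx, -⟩ := mul_eq_mul_prime_prod (a := 1) (x := g) (y := q)
    (s := s) (p := fun i => X - C (y i)) (fun i _ => prime_X_sub_C _) (by rw [one_mul, hq])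
  refine ⟨t, htu ▸ Finset.subset_union_left, ?_⟩
  have hm : (∏ i ∈ t, (X - C (y i))).Monic := monic_prod_of_monic _ _ fun i _ => monic_X_sub_C _
  have hb : b.Monic := hm.of_mul_monic_right (hx ▸ hg)
  rw [hx, hb.eq_one_of_isUnit (.of_mul_eq_one _ hbc.symm), one_mul]

lemma exists_monic_dvd_of_not_irreducible {k : Type*} [Field k] {p : k[X]} (hp : p.Monic)
    (hd : 0 < p.natDegree) (h : ¬ Irreducible p) :
    ∃ g : k[X], g.Monic ∧ g ∣ p ∧ 0 < g.natDegree ∧ g.natDegree < p.natDegree := by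
  rw [hp.irreducible_iff_natDegree'] at h
  push Not at h
  obtain ⟨f, g, hf, hg, hfg, hgd⟩ := h (by rintro rfl; simp at hd)
  rw [Finset.mem_Ioc] at hgd
  exact ⟨g, hg, ⟨f, by rw [← hfg, mul_comm]⟩, hgd.1, by omega⟩


lemma tendsto_add_largeFilter {O 𝕜 : Type*} [CommRing O] [NontriviallyNormedField 𝕜] [Algebra O 𝕜]
    (a : O) : Tendsto (fun x => x + a) (largeFilter O 𝕜) (largeFilter O 𝕜) := by
  refine tendsto_comap_iff.2 (tendsto_atTop_mono (fun x => ?_)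
    (tendsto_atTop_add_const_right _ (-‖algebraMap O 𝕜 a‖) tendsto_comap))
  have := norm_sub_le (algebraMap O 𝕜 (x + a)) (algebraMap O 𝕜 a)
  rw [map_add, add_sub_cancel_right] at this
  simp only [Function.comp_apply, map_add]
  linarith

/-- The polynomials `Q` assemble to a monic `G` whose fibre at `u` divides that of `f` for all small
`u`. The coefficients of the remainder of `f` modulo `G` are polynomials with infinitely many zeros,
so the remainder is zero. -/
lemma exists_monic_dvd_of_coeff_eventuallyEq {k 𝕜 ι : Type*} [Field k]
    [NontriviallyNormedField 𝕜] [Algebra k 𝕜] [Fintype ι] {f : k[X][X]} {y : ι → 𝕜 → 𝕜}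
    (hy : ∀ᶠ u in 𝓝 0, (f.map (mapRingHom (algebraMap k 𝕜))).map (evalRingHom u) =
      ∏ i, (X - C (y i u))) (I : Finset ι)
    (hI : ∀ j, ∃ Q : k[X], ∀ᶠ u in 𝓝 0,
      (∏ i ∈ I, (X - C (y i u))).coeff j = (Q.map (algebraMap k 𝕜)).eval u) :
    ∃ G : k[X][X], G.Monic ∧ G ∣ f ∧ G.natDegree = I.card := by
  choose Q hQ using hI
  set G : k[X][X] := X ^ I.card + ∑ j ∈ Finset.range I.card, C (Q j) * X ^ j with hG
  have hlt : (∑ j ∈ Finset.range I.card, C (Q j) * X ^ j).degree < (I.card : WithBot ℕ) := by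
    refine (degree_sum_le _ _).trans_lt ((Finset.sup_lt_iff (WithBot.bot_lt_coe _)).2 fun j hj => ?_)
    exact (degree_C_mul_X_pow_le _ _).trans_lt (by exact_mod_cast Finset.mem_range.1 hj)
  have hGm : G.Monic := monic_X_pow_add hlt
  have hGd : G.natDegree = I.card := by
    rw [hG, natDegree_add_eq_left_of_degree_lt (by rwa [degree_X_pow]), natDegree_X_pow]
  refine ⟨G, hGm, ?_, hGd⟩
  have hGu : ∀ᶠ u in 𝓝 0, (G.map (mapRingHom (algebraMap k 𝕜))).map (evalRingHom u) =
      ∏ i ∈ I, (X - C (y i u)) := by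
    filter_upwards [(Filter.eventually_all_finset (Finset.range I.card)).2 fun j _ => hQ j]
      with u hu
    have hm : (∏ i ∈ I, (X - C (y i u))).Monic :=
      monic_prod_of_monic _ _ fun i _ => monic_X_sub_C _
    have hd : (∏ i ∈ I, (X - C (y i u))).natDegree = I.card := by
      rw [natDegree_prod_of_monic _ _ fun i _ => monic_X_sub_C _]; simp
    rw [hm.as_sum, hd, hG]
    simp only [Polynomial.map_add, Polynomial.map_pow, map_X, Polynomial.map_sum,
      Polynomial.map_mul, map_C, coe_mapRingHom, coe_evalRingHom]
    congr 1
    exact Finset.sum_congr rfl fun j hj => by rw [hu j hj]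
  rw [← modByMonic_eq_zero_iff_dvd hGm]
  set r := f %ₘ G
  have hr : r.map (mapRingHom (algebraMap k 𝕜)) = 0 := by
    ext1 j
    rw [coeff_zero]
    refine eq_zero_of_infinite_isRoot _ ((infinite_of_mem_nhds (0 : 𝕜) (hy.and hGu)).mono ?_)
    rintro u ⟨h1, h2⟩
    have h3 : (r.map (mapRingHom (algebraMap k 𝕜))).map (evalRingHom u) = 0 := by
      rw [map_modByMonic _ hGm, map_modByMonic _ (hGm.map _), h1, h2,
        modByMonic_eq_zero_iff_dvd (monic_prod_of_monic _ _ fun i _ => monic_X_sub_C _)]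
      exact Finset.prod_dvd_prod_of_subset _ _ _ (Finset.subset_univ _)
    have h4 := congr_arg (fun q => q.coeff j) h3
    simpa using h4
  exact (Polynomial.map_eq_zero_iff (map_injective _ (algebraMap k 𝕜).injective)).1 hr

variable [NontriviallyNormedField 𝕜] [CharZero 𝕜] [Algebra k 𝕜] [Algebra O 𝕜]
  [IsScalarTower O k 𝕜]

/-- If all large `m` gave reducible specialisations, each would select a proper nonempty set of
analytic roots. Pigeonhole finds `n + 1` shifts of one large `x` that select the same set `J`. By
`eventually_not_forall_exists_eq` the coefficients of the product over `J` are polynomials in `u`,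
by interpolation they are defined over `k`, and so they give a proper factor of `f`. -/
theorem frequently_irreducible_of_separable [IsIntegrallyClosed O] [CompleteSpace 𝕜]
    [(largeFilter O 𝕜).NeBot]
    (hO : ∀ a : O, algebraMap O 𝕜 a ≠ 0 → 1 ≤ ‖algebraMap O 𝕜 a‖)
    (hsplit : ∀ p : k[X], (p.map (algebraMap k 𝕜)).Splits)
    {f : k[X][X]} (hf : f.Monic) (hirr : Irreducible f)
    (hsep : (f.map (evalRingHom 0)).Separable) :
    ∃ᶠ m in largeFilter O 𝕜, Irreducible (f.map (evalRingHom (algebraMap O k m)⁻¹)) := by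
  classical
  have hOk : Function.Injective (algebraMap O 𝕜) := by
    rw [IsScalarTower.algebraMap_eq O k 𝕜]
    exact (algebraMap k 𝕜).injective.comp (IsFractionRing.injective O k)
  have : CharZero O := ⟨fun a b h => by
    have := congr_arg (algebraMap O 𝕜) h
    simpa using this⟩
  have hcomp (x : O) : algebraMap k 𝕜 (algebraMap O k x) = algebraMap O 𝕜 x :=
    (IsScalarTower.algebraMap_apply O k 𝕜 x).symm
  set F := f.map (mapRingHom (algebraMap k 𝕜)) with hFdef
  have hF : F.Monic := hf.map _
  have hFd : F.natDegree = f.natDegree := hf.natDegree_map _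
  have hFu (t : k) : F.map (evalRingHom (algebraMap k 𝕜 t)) =
      (f.map (evalRingHom t)).map (algebraMap k 𝕜) := by
    rw [hFdef, Polynomial.map_map, Polynomial.map_map]
    congr 1
    ext <;> simp
  have hF0 := hFu 0
  rw [map_zero] at hF0
  have hfact := exists_analyticAt_factorization hF (hF0 ▸ hsplit _) (hF0 ▸ hsep.map)
  set d := F.natDegree with hd
  obtain ⟨y, hya, hy⟩ := hfact
  have hd0 : 0 < d := by
    rw [hFd, Nat.pos_iff_ne_zero]
    exact fun h => hirr.not_isUnit (by rw [hf.natDegree_eq_zero.1 h]; exact isUnit_one)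
  obtain ⟨b, hb0, E, hbE⟩ := exists_denominator_of_dvd_eval_inv (O := O) hf
  by_contra hcon
  rw [not_frequently] at hcon
  let φ : Finset (Fin d) → ℕ → 𝕜 → 𝕜 := fun I j u => (∏ i ∈ I, (X - C (y i u))).coeff j
  have hφ (I j) : AnalyticAt 𝕜 (φ I j) 0 := analyticAt_coeff_prod_X_sub_C hya I j
  let Good : Finset (Fin d) → ℕ → Prop := fun I j =>
    ∃ P : 𝕜[X], P.natDegree ≤ E ∧ ∀ᶠ u in 𝓝 0, φ I j u = P.eval u
  have hP (I j) : ∃ P : 𝕜[X], Good I j → P.natDegree ≤ E ∧ ∀ᶠ u in 𝓝 0, φ I j u = P.eval u := by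
    by_cases h : Good I j
    · obtain ⟨P, hP⟩ := h; exact ⟨P, fun _ => hP⟩
    · exact ⟨0, fun h' => absurd h' h⟩
  choose P hP using hP
  -- each large `m` gives a monic factor indexed by a set of roots
  have hfac : ∀ᶠ m in largeFilter O 𝕜, ∃ I : Finset (Fin d), 0 < I.card ∧ I.card < d ∧
      ∀ j, (∃ a : k, algebraMap k 𝕜 a = φ I j (algebraMap O 𝕜 m)⁻¹) ∧
        ∃ a : O, algebraMap O 𝕜 a = algebraMap O 𝕜 b * algebraMap O 𝕜 m ^ E *
          φ I j (algebraMap O 𝕜 m)⁻¹ := by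
    filter_upwards [hcon, tendsto_largeFilter.eventually (nhdsWithin_le_nhds hy),
      tendsto_largeFilter.eventually self_mem_nhdsWithin] with m h1 h2 h3
    have hm0 : m ≠ 0 := by rintro rfl; simp at h3
    have hpm : (f.map (evalRingHom (algebraMap O k m)⁻¹)).Monic := hf.map _
    have hpd : (f.map (evalRingHom (algebraMap O k m)⁻¹)).natDegree = d := by
      rw [hf.natDegree_map, hFd]
    obtain ⟨g, hg, hgp, hg0, hgd⟩ := exists_monic_dvd_of_not_irreducible hpm (hpd ▸ hd0) h1
    have hgmap : g.map (algebraMap k 𝕜) ∣ ∏ i, (X - C (y i (algebraMap O 𝕜 m)⁻¹)) := by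
      rw [← h2, ← hcomp, ← map_inv₀, hFu]
      exact Polynomial.map_dvd _ hgp
    obtain ⟨I, -, hI⟩ := exists_finset_of_dvd_prod_X_sub_C (hg.map _) hgmap
    have hcard : I.card = g.natDegree := by
      rw [← hg.natDegree_map (algebraMap k 𝕜), hI,
        natDegree_prod_of_monic _ _ fun i _ => monic_X_sub_C _]
      simp
    have hcoef (j) : algebraMap k 𝕜 (g.coeff j) = φ I j (algebraMap O 𝕜 m)⁻¹ := by
      rw [← coeff_map, hI]
    refine ⟨I, by omega, by omega, fun j => ⟨⟨_, hcoef j⟩, ?_⟩⟩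
    obtain ⟨a, ha⟩ := hbE m hm0 g hg hgp j
    refine ⟨a, ?_⟩
    rw [← hcoef, ← hcomp, ← hcomp, ← hcomp, ha]
    simp
  -- One `n` serves the finitely many pairs `(I, j)`, and `E ≤ n` leaves enough points to
  -- interpolate polynomials of degree at most `E`.
  obtain ⟨n, hn, hnE⟩ : ∃ n : ℕ, (∀ I : Finset (Fin d), ∀ j : Fin (d + 1), ¬ Good I j →
      ∀ ν : Fin (n + 1) → ℤ, Function.Injective ν → ∀ᶠ x in largeFilter O 𝕜,
      ¬ ∀ i, ∃ a : O, algebraMap O 𝕜 a = algebraMap O 𝕜 b * algebraMap O 𝕜 (x + ν i) ^ E *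
        φ I j (algebraMap O 𝕜 (x + ν i))⁻¹) ∧ E ≤ n := by
    refine ((eventually_all.2 fun I => eventually_all.2 fun j : Fin (d + 1) => ?_).and
      (eventually_ge_atTop E)).exists
    by_cases h : Good I j
    · exact .of_forall fun n h' => absurd h h'
    · obtain ⟨n₀, hn₀⟩ := eventually_not_forall_exists_eq hO
        ((map_ne_zero_iff _ hOk).2 hb0) (hφ I j) h
      filter_upwards [eventually_ge_atTop n₀] with n hn _ using hn₀ n hn
  -- With this many shifts, some subset of the roots is selected more than `n` times.
  set B := Fintype.card (Finset (Fin d)) * n + 1 with hB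
  have hall : ∀ᶠ x in largeFilter O 𝕜, ∀ ν : Fin (n + 1) → Fin B, Function.Injective ν →
      ∀ I : Finset (Fin d), ∀ j : Fin (d + 1), ¬ Good I j →
      ¬ ∀ i, ∃ a : O, algebraMap O 𝕜 a = algebraMap O 𝕜 b *
        algebraMap O 𝕜 (x + ((ν i : ℕ) : ℤ)) ^ E *
        φ I j (algebraMap O 𝕜 (x + ((ν i : ℕ) : ℤ)))⁻¹ := by
    refine eventually_all.2 fun ν => eventually_imp_distrib_left.2 fun hν =>
      eventually_all.2 fun I => eventually_all.2 fun j => eventually_imp_distrib_left.2 fun hI =>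
      hn I j hI _ fun i j hij => hν (Fin.ext (by exact_mod_cast hij))
  have hfac' : ∀ᶠ x in largeFilter O 𝕜, ∀ ν : Fin B, _ := eventually_all.2 fun ν : Fin B =>
    (tendsto_add_largeFilter (((ν : ℕ) : ℤ) : O)).eventually hfac
  have hval : ∀ᶠ x in largeFilter O 𝕜, ∀ ν : Fin B, ∀ I : Finset (Fin d), ∀ j : Fin (d + 1),
      Good I j → φ I j (algebraMap O 𝕜 (x + ((ν : ℕ) : ℤ)))⁻¹ =
        (P I j).eval (algebraMap O 𝕜 (x + ((ν : ℕ) : ℤ)))⁻¹ :=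
    eventually_all.2 fun ν => eventually_all.2 fun I => eventually_all.2 fun j =>
      eventually_imp_distrib_left.2 fun h => (tendsto_add_largeFilter _).eventually
        (tendsto_largeFilter.eventually (nhdsWithin_le_nhds (hP I j h).2))
  obtain ⟨x, hx1, hx2, hx3⟩ := (hall.and (hfac'.and hval)).exists
  choose I hI0 hId hI using hx2
  obtain ⟨J, hJ⟩ := Fintype.exists_lt_card_fiber_of_mul_lt_card (n := n) I (by simp [hB])
  obtain ⟨T, hTJ, hT⟩ := Finset.exists_subset_card_eq (Nat.succ_le_of_lt hJ)
  set ν := T.orderEmbOfFin hT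
  have hνJ (i) : I (ν i) = J := by
    have := hTJ (T.orderEmbOfFin_mem hT i)
    simpa using this
  have hJ0 : 0 < J.card := hνJ 0 ▸ hI0 _
  have hJd : J.card < d := hνJ 0 ▸ hId _
  have hgood (j : ℕ) (hj : j ≤ d) : Good J j := by
    by_contra h
    refine hx1 ν ν.injective J ⟨j, by omega⟩ h fun i => ?_
    have := (hI (ν i) j).2
    rwa [hνJ] at this
  have hQ (j : ℕ) : ∃ Q : k[X], ∀ᶠ u in 𝓝 0, φ J j u = (Q.map (algebraMap k 𝕜)).eval u := by
    rcases le_or_gt j d with hj | hj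
    · have hg := hgood j hj
      have ht : Function.Injective fun i : Fin (n + 1) =>
          (algebraMap O k (x + ((ν i : ℕ) : ℤ)))⁻¹ := fun i i' h => by
        have h' := IsFractionRing.injective O k (inv_injective h)
        have h'' : ((ν i : ℕ) : O) = (ν i' : ℕ) := by simpa using h'
        exact ν.injective (Fin.ext (Nat.cast_injective h''))
      obtain ⟨Q, hQ⟩ := exists_map_eq_of_eval_mem ht ((hP J j hg).1.trans hnE) fun i => by
        rw [map_inv₀, hcomp, ← hx3 (ν i) J ⟨j, by omega⟩ hg]
        have := (hI (ν i) j).1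
        rwa [hνJ] at this
      exact ⟨Q, by rw [hQ]; exact (hP J j hg).2⟩
    · refine ⟨0, .of_forall fun u => ?_⟩
      rw [Polynomial.map_zero, eval_zero]
      refine coeff_eq_zero_of_natDegree_lt ?_
      rw [natDegree_prod_of_monic _ _ fun i _ => monic_X_sub_C _]
      simp only [natDegree_X_sub_C, Finset.sum_const, smul_eq_mul, mul_one]
      omega
  obtain ⟨G, hG, ⟨q, hq⟩, hGd⟩ := exists_monic_dvd_of_coeff_eventuallyEq hy J hQ
  rcases hirr.isUnit_or_isUnit hq with h | h
  · rw [hG.eq_one_of_isUnit h, natDegree_one] at hGd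
    omega
  · have hqm : q.Monic := hG.of_mul_monic_left (hq ▸ hf)
    rw [hqm.eq_one_of_isUnit h, mul_one] at hq
    rw [hq] at hFd
    omega

end Hilbert

end

/-! ### Hilbertian fields from a discrete ring in a complete normed field -/

section

open Polynomial Filter Topology Asymptotics

/-- A field over which monic irreducible polynomials `f(t, Y)` have irreducible specialisations. -/
def IsHilbertian (k : Type*) [Field k] : Prop :=
  ∀ f : k[X][X], f.Monic → Irreducible f → ∀ s : Finset k,
    ∃ t ∉ s, Irreducible (f.map (evalRingHom t))

lemma exists_C_eq_mul_add_mul_derivative {k : Type*} [Field k] [CharZero k] {f : k[X][X]}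
    (hf : f.Monic) (hirr : Irreducible f) :
    ∃ (a b : k[X][X]) (δ : k[X]), δ ≠ 0 ∧ a * f + b * derivative f = C δ := by
  have hirr' : Irreducible (f.map (algebraMap k[X] (FractionRing k[X]))) :=
    (hf.irreducible_iff_irreducible_map_fraction_map).1 hirr
  obtain ⟨a, b, hab⟩ := hirr'.separable
  obtain ⟨c, hc0, hc⟩ := IsLocalization.integerNormalization_spec (nonZeroDivisors k[X]) a
  obtain ⟨e, he0, he⟩ := IsLocalization.integerNormalization_spec (nonZeroDivisors k[X]) b
  set a' := IsLocalization.integerNormalization (nonZeroDivisors k[X]) a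
  set b' := IsLocalization.integerNormalization (nonZeroDivisors k[X]) b
  refine ⟨C e * a', C c * b', c * e,
    mul_ne_zero (nonZeroDivisors.ne_zero hc0) (nonZeroDivisors.ne_zero he0), ?_⟩
  refine map_injective _ (IsFractionRing.injective k[X] (FractionRing k[X])) ?_
  simp only [Polynomial.map_add, Polynomial.map_mul, map_C, hc, he, ← derivative_map,
    Algebra.smul_def, Polynomial.algebraMap_apply, map_mul]
  linear_combination C (algebraMap k[X] (FractionRing k[X]) c) *
    C (algebraMap k[X] (FractionRing k[X]) e) * hab

lemma exists_separable_specialization {k : Type*} [Field k] [CharZero k] {f : k[X][X]}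
    (hf : f.Monic) (hirr : Irreducible f) : ∃ t : k, (f.map (evalRingHom t)).Separable := by
  obtain ⟨a, b, δ, hδ, hab⟩ := exists_C_eq_mul_add_mul_derivative hf hirr
  obtain ⟨t, ht⟩ : ∃ t, δ.eval t ≠ 0 := by
    by_contra! h
    exact hδ (funext fun t => by simp [h t])
  refine ⟨t, C (δ.eval t)⁻¹ * a.map (evalRingHom t), C (δ.eval t)⁻¹ * b.map (evalRingHom t), ?_⟩
  have := congr_arg (Polynomial.map (evalRingHom t)) hab
  simp only [Polynomial.map_add, Polynomial.map_mul, map_C, coe_evalRingHom, derivative_map]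
    at this ⊢
  rw [mul_assoc, mul_assoc, ← mul_add, this, ← C_mul, inv_mul_cancel₀ ht, C_1]

theorem isHilbertian_of_norm (O k 𝕜 : Type*) [CommRing O] [IsDomain O] [Field k] [Algebra O k]
    [IsFractionRing O k] [IsIntegrallyClosed O] [NontriviallyNormedField 𝕜] [CharZero 𝕜]
    [CompleteSpace 𝕜] [Algebra k 𝕜] [Algebra O 𝕜] [IsScalarTower O k 𝕜]
    (hO : ∀ a : O, a ≠ 0 → 1 ≤ ‖algebraMap O 𝕜 a‖) (hO' : ∀ r : ℝ, ∃ a : O, r ≤ ‖algebraMap O 𝕜 a‖)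
    (hsplit : ∀ p : k[X], (p.map (algebraMap k 𝕜)).Splits) : IsHilbertian k := by
  classical
  intro f hf hirr s
  have : CharZero k := (RingHom.charZero_iff (algebraMap k 𝕜).injective).2 inferInstance
  have : (largeFilter O 𝕜).NeBot := by
    refine comap_neBot_iff.2 fun S hS => ?_
    obtain ⟨r, hr⟩ := mem_atTop_sets.1 hS
    obtain ⟨a, ha⟩ := hO' r
    exact ⟨a, hr _ ha⟩
  obtain ⟨t, ht⟩ := exists_separable_specialization hf hirr
  -- Translate the parameter so that the separable fibre lies over `0`.
  let e : k[X] ≃+* k[X] := (algEquivAevalXAddC t).toRingEquiv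
  have he (u : k) : (evalRingHom u).comp (e : k[X] →+* k[X]) = evalRingHom (u + t) := by
    ext <;> simp [e]
  have hmap (u : k) : (f.map (e : k[X] →+* k[X])).map (evalRingHom u) =
      f.map (evalRingHom (u + t)) := by rw [Polynomial.map_map, he]
  have hirr' : Irreducible (f.map (e : k[X] →+* k[X])) :=
    (MulEquiv.irreducible_iff (Polynomial.mapEquiv e)).2 hirr
  have hfreq := frequently_irreducible_of_separable (O := O) (𝕜 := 𝕜) (fun a ha => hO a
    (by rintro rfl; simp at ha)) hsplit (hf.map (e : k[X] →+* k[X])) hirr'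
    (by rw [hmap, zero_add]; exact ht)
  -- Since `1/m` tends to `0` through nonzero values, it eventually avoids any finite set.
  have hev : ∀ᶠ m in largeFilter O 𝕜, (algebraMap O k m)⁻¹ + t ∉ s := by
    have h1 : ∀ᶠ u : 𝕜 in 𝓝[≠] 0, u ∉ s.image fun c => algebraMap k 𝕜 (c - t) := by
      exact (nhdsNE_le_cofinite (0 : 𝕜)) (Finset.finite_toSet _).compl_mem_cofinite
    filter_upwards [tendsto_largeFilter.eventually h1] with m hm hms
    refine hm (Finset.mem_image.2 ⟨_, hms, ?_⟩)
    rw [add_sub_cancel_right, map_inv₀, ← IsScalarTower.algebraMap_apply]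
  obtain ⟨m, hm1, hm2⟩ := (hfreq.and_eventually hev).exists
  exact ⟨_, hm2, by rwa [hmap] at hm1⟩

theorem isHilbertian_rat : IsHilbertian ℚ := by
  refine isHilbertian_of_norm ℤ ℚ ℂ (fun a ha => ?_) (fun r => ?_) fun p => IsAlgClosed.splits _
  · simpa using Int.one_le_abs ha |> fun h => (by exact_mod_cast h : (1 : ℝ) ≤ |(a : ℝ)|)
  · obtain ⟨n, hn⟩ := exists_nat_ge r
    exact ⟨n, by simpa using hn⟩

/-- Over a complete ultrametric field no splitting hypothesis is needed: one may pass to the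
completion of an algebraic closure. -/
theorem isHilbertian_of_ultrametric (O k 𝕜 : Type*) [CommRing O] [IsDomain O] [Field k]
    [Algebra O k] [IsFractionRing O k] [IsIntegrallyClosed O] [NontriviallyNormedField 𝕜]
    [CharZero 𝕜] [CompleteSpace 𝕜] [IsUltrametricDist 𝕜] (φ : O →+* 𝕜)
    (hO : ∀ a : O, a ≠ 0 → 1 ≤ ‖φ a‖) (hO' : ∀ r : ℝ, ∃ a : O, r ≤ ‖φ a‖) :
    IsHilbertian k := by
  have hφ : Function.Injective φ := (injective_iff_map_eq_zero φ).2 fun a ha => by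
    by_contra h
    have := hO a h
    simp [ha] at this
    linarith
  let _ : NontriviallyNormedField (AlgebraicClosure 𝕜) := spectralNorm.nontriviallyNormedField 𝕜 _
  let _ : NormedAlgebra 𝕜 (AlgebraicClosure 𝕜) := spectralNorm.normedAlgebra 𝕜 _
  let Ω := UniformSpace.Completion (AlgebraicClosure 𝕜)
  let _ : NontriviallyNormedField Ω := {
    (inferInstance : NormedField Ω) with
    non_trivial := by
      obtain ⟨x, hx⟩ := NontriviallyNormedField.non_trivial (α := AlgebraicClosure 𝕜)
      exact ⟨(x : Ω), by rwa [UniformSpace.Completion.norm_coe]⟩ }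
  let ψ : AlgebraicClosure 𝕜 →+* Ω := UniformSpace.Completion.coeRingHom
  let θ : k →+* 𝕜 := IsFractionRing.lift hφ
  have hθ (x : O) : θ (algebraMap O k x) = φ x := IsFractionRing.lift_algebraMap hφ x
  let _ : Algebra k Ω := (ψ.comp ((algebraMap 𝕜 (AlgebraicClosure 𝕜)).comp θ)).toAlgebra
  let _ : Algebra O Ω := (ψ.comp ((algebraMap 𝕜 (AlgebraicClosure 𝕜)).comp φ)).toAlgebra
  have hst : IsScalarTower O k Ω := .of_algebraMap_eq fun x => by
    change ψ _ = ψ (algebraMap 𝕜 _ (θ (algebraMap O k x)))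
    rw [hθ]; rfl
  have hnorm (a : O) : ‖algebraMap O Ω a‖ = ‖φ a‖ := by
    change ‖((algebraMap 𝕜 (AlgebraicClosure 𝕜) (φ a) : AlgebraicClosure 𝕜) : Ω)‖ = _
    rw [UniformSpace.Completion.norm_coe, norm_algebraMap']
  have : CharZero Ω := charZero_of_injective_ringHom
    (ψ.comp (algebraMap 𝕜 (AlgebraicClosure 𝕜))).injective
  refine isHilbertian_of_norm O k Ω (fun a ha => by rw [hnorm]; exact hO a ha)
    (fun r => by simp_rw [hnorm]; exact hO' r) fun p => ?_
  have : algebraMap k Ω = ψ.comp ((algebraMap 𝕜 (AlgebraicClosure 𝕜)).comp θ) := rfl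
  rw [this, ← Polynomial.map_map]
  -- Polynomials over `k` split already in the algebraic closure of `𝕜`, so it does not matter here
  -- whether its completion is algebraically closed.
  exact (IsAlgClosed.splits _).map _

-- Sending `X` to the inverse of the Laurent parameter turns polynomials into Laurent series
-- supported in degrees at most `0`. So nonzero polynomials have norm at least `1` and the powers of
-- `X` are unbounded: `F[X]` plays the role of `ℤ`.
open LaurentSeries WithZero in
theorem isHilbertian_of_isFractionRing_polynomial (F k : Type*) [Field F] [CharZero F] [Field k]
    [Algebra F[X] k] [IsFractionRing F[X] k] : IsHilbertian k := by
  have hv1 : Valued.v (HahnSeries.single (-1) 1 : F⸨X⸩) = exp 1 := by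
    simpa using valuation_single_zpow (K := F) (-1)
  have hv : (Valued.v : Valuation F⸨X⸩ ℤᵐ⁰).IsNontrivial :=
    ⟨HahnSeries.single (-1) 1, by rw [hv1]; exact ⟨by simp, by simp [← exp_zero]⟩⟩
  let _ : (Valued.v : Valuation F⸨X⸩ ℤᵐ⁰).RankOne :=
    Valuation.IsRankOneDiscrete.rankOne (e := 2) _ (by norm_num)
  let _ := Valued.toNontriviallyNormedField F⸨X⸩ ℤᵐ⁰
  have : CharZero F⸨X⸩ := (RingHom.charZero_iff (HahnSeries.C (Γ := ℤ) (R := F)).injective).1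
    inferInstance
  let φ : F[X] →+* F⸨X⸩ := eval₂RingHom HahnSeries.C (HahnSeries.single (-1) 1)
  have hφ (p : F[X]) (n : ℕ) : (φ p).coeff (-n) = p.coeff n := by
    induction p using Polynomial.induction_on' with
    | add p q hp hq => rw [map_add, HahnSeries.coeff_add, hp, hq, coeff_add]
    | monomial m a =>
      have : φ (monomial m a) = HahnSeries.single (-m : ℤ) a := by
        simp [φ, HahnSeries.single_pow, HahnSeries.C_apply, HahnSeries.single_mul_single]
      rw [this, HahnSeries.coeff_single, coeff_monomial]
      simp [eq_comm]
  have hφX : φ X = HahnSeries.single (-1) 1 := by simp [φ]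
  refine isHilbertian_of_ultrametric F[X] k F⸨X⸩ φ (fun p hp => ?_) fun r => ?_
  · rw [Valued.toNormedField.one_le_norm_iff]
    by_contra! hlt
    refine hp (Polynomial.ext fun n => ?_)
    rw [← hφ, coeff_zero]
    -- Norm below `1` means valuation at most `exp (-1)`, so the coefficients in degrees less than
    -- `1` vanish, and these include all degrees `-n`.
    refine coeff_zero_of_lt_valuation F (D := 1) ?_ (by omega)
    rw [← lt_mul_exp_iff_le (by simp), ← exp_add]
    simpa using hlt
  · obtain ⟨n, hn⟩ := pow_unbounded_of_one_lt r
      ((Valued.toNormedField.one_lt_norm_iff (x := φ X)).2 (by rw [hφX, hv1]; simp [← exp_zero]))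
    exact ⟨X ^ n, by rw [map_pow, norm_pow]; exact hn.le⟩

end

/-! ### Finitely generated fields are finite over Hilbertian fields -/

section

open Polynomial

lemma IsHilbertian.of_ringEquiv {k k' : Type*} [Field k] [Field k'] (e : k ≃+* k')
    (h : IsHilbertian k) : IsHilbertian k' := by
  classical
  intro f hf hirr s
  let e₁ : k'[X] ≃+* k[X] := mapEquiv e.symm
  obtain ⟨t, ht, hirr'⟩ := h (f.map (e₁ : k'[X] →+* k[X])) (hf.map _)
    ((MulEquiv.irreducible_iff (mapEquiv e₁)).2 hirr) (s.image e.symm)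
  refine ⟨e t, fun hts => ht (Finset.mem_image.2 ⟨_, hts, e.symm_apply_apply t⟩), ?_⟩
  have h1 : (f.map (evalRingHom (e t))).map (e.symm : k' →+* k) =
      (f.map (e₁ : k'[X] →+* k[X])).map (evalRingHom t) := by
    rw [Polynomial.map_map, Polynomial.map_map]
    congr 1
    ext <;> simp [e₁]
  exact (MulEquiv.irreducible_iff (mapEquiv e.symm)).1 (h1 ▸ hirr' :)

/-- A field finitely generated over `ℚ` is finite over a Hilbertian field. -/
theorem exists_isHilbertian_finiteDimensional {k : Type u} [Field k] [CharZero k]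
    (hk : (⊤ : IntermediateField ℚ k).FG) :
    ∃ (k' : Type u) (_ : Field k') (_ : Algebra k' k), FiniteDimensional k' k ∧
      IsHilbertian k' := by
  have hess : Algebra.EssFiniteType ℚ k := IntermediateField.fg_top_iff.1 hk
  obtain ⟨s, hs⟩ := exists_isTranscendenceBasis ℚ k
  have halg := hs.isAlgebraic_field
  rw [Subtype.range_coe] at halg
  have hfin (K : IntermediateField ℚ k) (h : IntermediateField.adjoin ℚ s ≤ K) :
      FiniteDimensional K k := by
    have h1 : Algebra.IsAlgebraic K k := by
      let _ : Algebra (IntermediateField.adjoin ℚ s) K :=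
        (IntermediateField.inclusion h).toRingHom.toAlgebra
      have : IsScalarTower (IntermediateField.adjoin ℚ s) K k := .of_algebraMap_eq fun _ => rfl
      exact Algebra.IsAlgebraic.tower_top (K := IntermediateField.adjoin ℚ s) K
    have h2 : Algebra.EssFiniteType K k := Algebra.EssFiniteType.of_comp ℚ K k
    exact Algebra.finite_of_essFiniteType_of_isAlgebraic
  rcases s.eq_empty_or_nonempty with rfl | ⟨x, hx⟩
  · exact ⟨_, _, _, hfin ⊥ (by simp), isHilbertian_rat.of_ringEquiv
      (IntermediateField.botEquiv ℚ k).symm.toRingEquiv⟩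
  -- Splitting off one element of the transcendence basis exhibits the field generated by the basis
  -- as the rational function field `F(x)`.
  · let F := IntermediateField.adjoin ℚ (s \ {x})
    have htr : Transcendental F x := by
      have := hs.1.transcendental_adjoin (s := {i | (i : k) ≠ x}) (i := ⟨x, hx⟩) (by simp)
      have himage : (Subtype.val : s → k) '' {i | (i : k) ≠ x} = s \ {x} := by
        ext y; simp [and_comm]
      rw [himage] at this
      exact fun h => this (IntermediateField.isAlgebraic_adjoin_iff.1 h)
    let K := IntermediateField.adjoin F {x}
    have : FiniteDimensional K k := by
      have := hfin (K.restrictScalars ℚ) (IntermediateField.adjoin_le_iff.2 fun y hy => ?_)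
      · exact this
      · rcases eq_or_ne y x with rfl | hyx
        · exact IntermediateField.subset_adjoin F _ rfl
        · exact K.algebraMap_mem ⟨y, IntermediateField.subset_adjoin ℚ _ ⟨hy, hyx⟩⟩
    refine ⟨K, inferInstance, inferInstance, this, ?_⟩
    exact (isHilbertian_of_isFractionRing_polynomial F (RatFunc F)).of_ringEquiv
      (RatFunc.algEquivOfTranscendental x htr).toRingEquiv

end

/-! ### The Gauss valuation of a power basis -/

section

open Polynomial

section GaussValuation

variable {E L Γ : Type*} [Field E] [Field L] [Algebra E L] [LinearOrderedCommGroupWithZero Γ]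
  (v : Valuation E Γ) (pb : PowerBasis E L)

/-- The maximum of the valuations of the coordinates with respect to a power basis. -/
noncomputable def gaussValue (x : L) : Γ :=
  Finset.univ.sup fun i => v (pb.basis.repr x i)

variable {v pb}

lemma gaussValue_le_iff {x : L} {γ : Γ} :
    gaussValue v pb x ≤ γ ↔ ∀ i, v (pb.basis.repr x i) ≤ γ := by
  simp [gaussValue]

lemma exists_eq_gaussValue (x : L) : ∃ i, v (pb.basis.repr x i) = gaussValue v pb x := by
  have : Nonempty (Fin pb.dim) := ⟨⟨0, pb.dim_pos⟩⟩
  obtain ⟨i, -, hi⟩ := Finset.exists_mem_eq_sup Finset.univ Finset.univ_nonempty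
    fun i => v (pb.basis.repr x i)
  exact ⟨i, hi.symm⟩

lemma gaussValue_zero : gaussValue v pb 0 = 0 := by
  obtain ⟨i, hi⟩ := exists_eq_gaussValue (v := v) (pb := pb) 0
  simpa using hi.symm

lemma gaussValue_eq_zero_iff {x : L} : gaussValue v pb x = 0 ↔ x = 0 := by
  refine ⟨fun h => ?_, fun h => h ▸ gaussValue_zero⟩
  refine pb.basis.repr.map_eq_zero_iff.1 (Finsupp.ext fun i => ?_)
  have := gaussValue_le_iff.1 h.le i
  simpa using this

lemma gaussValue_add_le (x y : L) :
    gaussValue v pb (x + y) ≤ max (gaussValue v pb x) (gaussValue v pb y) := by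
  refine gaussValue_le_iff.2 fun i => ?_
  rw [map_add, Finsupp.add_apply]
  exact (v.map_add _ _).trans (max_le_max (gaussValue_le_iff.1 le_rfl i)
    (gaussValue_le_iff.1 le_rfl i))

lemma gaussValue_smul (a : E) (x : L) : gaussValue v pb (a • x) = v a * gaussValue v pb x := by
  refine le_antisymm (gaussValue_le_iff.2 fun i => ?_) ?_
  · rw [map_smul, Finsupp.smul_apply, smul_eq_mul, map_mul]
    exact mul_le_mul_right (gaussValue_le_iff.1 le_rfl i) _
  · obtain ⟨i, hi⟩ := exists_eq_gaussValue (v := v) (pb := pb) x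
    rw [← hi, ← map_mul, ← smul_eq_mul, ← Finsupp.smul_apply, ← map_smul]
    exact gaussValue_le_iff.1 le_rfl i

lemma PowerBasis.repr_aeval {p : E[X]} (hp : p.natDegree < pb.dim) (i : Fin pb.dim) :
    pb.basis.repr (aeval pb.gen p) i = p.coeff i := by
  have : aeval pb.gen p = ∑ i : Fin pb.dim, p.coeff i • pb.basis i := by
    rw [aeval_eq_sum_range' hp, Finset.sum_range]
    simp
  rw [this, pb.basis.repr_sum_self]

lemma gaussValue_one : gaussValue v pb 1 = 1 := by
  have h (i : Fin pb.dim) := pb.repr_aeval (p := 1) (by simpa using pb.dim_pos) i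
  rw [map_one] at h
  refine le_antisymm (gaussValue_le_iff.2 fun i => ?_) ?_
  · rw [h, coeff_one]; split_ifs <;> simp
  · have := gaussValue_le_iff.1 (le_refl (gaussValue v pb 1)) ⟨0, pb.dim_pos⟩
    rwa [h, coeff_one_zero, map_one] at this

lemma exists_eq_smul_aeval {x : L} (hx : x ≠ 0) :
    ∃ (a : E) (p : v.valuationSubring[X]),
      x = a • aeval pb.gen (p.map (algebraMap v.valuationSubring E)) ∧
      gaussValue v pb (aeval pb.gen (p.map (algebraMap v.valuationSubring E))) = 1 := by
  obtain ⟨i, hi⟩ := exists_eq_gaussValue (v := v) (pb := pb) x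
  set a := pb.basis.repr x i
  have hva : v a ≠ 0 := by rwa [hi, Ne, gaussValue_eq_zero_iff]
  have ha : a ≠ 0 := by rintro h; simp [h] at hva
  have hle (j) : v (pb.basis.repr x j / a) ≤ 1 := by
    rw [map_div₀, div_le_one₀ (zero_lt_iff.2 hva), hi]
    exact gaussValue_le_iff.1 le_rfl j
  let p : v.valuationSubring[X] := ∑ j : Fin pb.dim, C ⟨_, hle j⟩ * X ^ (j : ℕ)
  have hp : x = a • aeval pb.gen (p.map (algebraMap v.valuationSubring E)) := by
    conv_lhs => rw [← pb.basis.sum_repr x]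
    simp only [p, Polynomial.map_sum, Polynomial.map_mul, map_C, Polynomial.map_pow, map_X,
      map_sum, map_mul, aeval_C, map_pow, aeval_X, Finset.smul_sum, pb.basis_eq_pow]
    refine Finset.sum_congr rfl fun j _ => ?_
    rw [← Algebra.smul_def, smul_smul]
    congr 1
    exact (mul_div_cancel₀ _ ha).symm
  refine ⟨a, p, hp, ?_⟩
  have h1 := gaussValue_smul (v := v) (pb := pb) a
    (aeval pb.gen (p.map (algebraMap v.valuationSubring E)))
  rw [← hp, ← hi] at h1
  exact (mul_right_eq_self₀.1 h1.symm).resolve_right hva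

variable {F : v.valuationSubring[X]} (hF : F.map (algebraMap _ E) = minpoly E pb.gen)

include hF

lemma monic_of_map_eq_minpoly : F.Monic := by
  refine monic_of_injective (f := algebraMap v.valuationSubring E) Subtype.val_injective ?_
  rw [hF]
  exact minpoly.monic pb.isIntegral_gen

lemma natDegree_of_map_eq_minpoly : F.natDegree = pb.dim := by
  rw [← (monic_of_map_eq_minpoly hF).natDegree_map (algebraMap v.valuationSubring E), hF,
    pb.natDegree_minpoly]

lemma repr_aeval_map (p : v.valuationSubring[X]) (i : Fin pb.dim) :
    pb.basis.repr (aeval pb.gen (p.map (algebraMap v.valuationSubring E))) i =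
      (p %ₘ F).coeff i := by
  have hm := monic_of_map_eq_minpoly hF
  have h1 : aeval pb.gen (p.map (algebraMap v.valuationSubring E)) =
      aeval pb.gen ((p %ₘ F).map (algebraMap v.valuationSubring E)) := by
    conv_lhs => rw [← modByMonic_add_div p F]
    rw [Polynomial.map_add, Polynomial.map_mul, hF, map_add, map_mul, minpoly.aeval, zero_mul,
      add_zero]
  rw [h1, pb.repr_aeval, coeff_map]
  · rfl
  · refine natDegree_map_le.trans_lt ?_
    have hd := natDegree_of_map_eq_minpoly hF
    rw [← hd]
    exact natDegree_modByMonic_lt _ hm (fun h => by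
      rw [h, natDegree_one] at hd
      exact pb.dim_pos.ne hd)

lemma gaussValue_aeval_le_one (p : v.valuationSubring[X]) :
    gaussValue v pb (aeval pb.gen (p.map (algebraMap v.valuationSubring E))) ≤ 1 := by
  refine gaussValue_le_iff.2 fun i => ?_
  rw [repr_aeval_map hF]
  exact ((p %ₘ F).coeff i).2

/-- The coordinates of `p(θ)` are the coefficients of the remainder of `p` modulo `F`, and these all
lie in the maximal ideal exactly when the reduced remainder vanishes. -/
lemma gaussValue_aeval_lt_one_iff (p : v.valuationSubring[X]) :
    gaussValue v pb (aeval pb.gen (p.map (algebraMap v.valuationSubring E))) < 1 ↔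
      F.map (IsLocalRing.residue v.valuationSubring) ∣
        p.map (IsLocalRing.residue v.valuationSubring) := by
  have hm := monic_of_map_eq_minpoly hF
  rw [← modByMonic_eq_zero_iff_dvd (hm.map _), ← map_modByMonic _ hm]
  have hlt : gaussValue v pb (aeval pb.gen (p.map (algebraMap v.valuationSubring E))) < 1 ↔
      ∀ i : Fin pb.dim, v ((p %ₘ F).coeff i) < 1 := by
    rw [gaussValue, Finset.sup_lt_iff (bot_eq_zero (α := Γ) ▸ zero_lt_one)]
    simp only [Finset.mem_univ, true_imp_iff, repr_aeval_map hF]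
  have hres (a : v.valuationSubring) : IsLocalRing.residue v.valuationSubring a = 0 ↔ v a < 1 := by
    rw [IsLocalRing.residue_eq_zero_iff, Valuation.mem_maximalIdeal_iff]
  rw [hlt]
  constructor
  · intro h
    ext i
    rw [coeff_map, coeff_zero, hres]
    rcases lt_or_ge i pb.dim with hi | hi
    · exact h ⟨i, hi⟩
    · rw [coeff_eq_zero_of_degree_lt]
      · simp
      · refine (degree_modByMonic_lt _ hm).trans_le ?_
        rw [degree_eq_natDegree hm.ne_zero, natDegree_of_map_eq_minpoly hF]
        exact_mod_cast hi
  · intro h i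
    rw [← hres, ← coeff_map, h, coeff_zero]

/-- After scaling both factors to Gauss value `1`, a product of smaller value would be divisible by
the reduction of `F`, which is prime; so one factor would have value below `1`. -/
lemma gaussValue_mul (hirr : Irreducible (F.map (IsLocalRing.residue v.valuationSubring)))
    (x y : L) : gaussValue v pb (x * y) = gaussValue v pb x * gaussValue v pb y := by
  rcases eq_or_ne x 0 with rfl | hx
  · simp [gaussValue_zero]
  rcases eq_or_ne y 0 with rfl | hy
  · simp [gaussValue_zero]
  obtain ⟨a, p, hx', hp⟩ := exists_eq_smul_aeval (v := v) (pb := pb) hx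
  obtain ⟨b, q, hy', hq⟩ := exists_eq_smul_aeval (v := v) (pb := pb) hy
  have hpq : gaussValue v pb (aeval pb.gen ((p * q).map (algebraMap v.valuationSubring E))) = 1 := by
    refine le_antisymm (gaussValue_aeval_le_one hF _) (not_lt.1 fun h => ?_)
    rw [gaussValue_aeval_lt_one_iff hF, Polynomial.map_mul] at h
    rcases hirr.prime.dvd_or_dvd h with h | h
    · exact absurd hp (ne_of_lt ((gaussValue_aeval_lt_one_iff hF p).2 h))
    · exact absurd hq (ne_of_lt ((gaussValue_aeval_lt_one_iff hF q).2 h))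
  rw [Polynomial.map_mul, map_mul] at hpq
  rw [hx', hy', smul_mul_smul_comm, gaussValue_smul, gaussValue_smul, gaussValue_smul, hp, hq, hpq]
  simp

/-- If the minimal polynomial of the generator is irreducible modulo the maximal ideal, then the
maximum of the valuations of the coordinates is a valuation. -/
noncomputable def gaussValuation
    (hirr : Irreducible (F.map (IsLocalRing.residue v.valuationSubring))) : Valuation L Γ where
  toFun := gaussValue v pb
  map_zero' := gaussValue_zero
  map_one' := gaussValue_one
  map_mul' := gaussValue_mul hF hirr
  map_add_le_max' := gaussValue_add_le

end GaussValuation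

end

/-! ### Continuous cohomology in degree one by homogeneous cochains -/

section

open Topology

section Homology

open Limits

variable {R : Type*} [Ring R] [TopologicalSpace R]

lemma TopModuleCat.exists_iso_coker {M N P : TopModuleCat R} {f : M ⟶ N} {p : N ⟶ P} {w : f ≫ p = 0}
    (h : IsColimit (CokernelCofork.ofπ p w)) :
    ∃ e : P ≅ TopModuleCat.coker f, p ≫ e.hom = TopModuleCat.cokerπ f :=
  ⟨h.coconePointUniqueUpToIso (TopModuleCat.isColimitCoker f),
    h.comp_coconePointUniqueUpToIso_hom (TopModuleCat.isColimitCoker f) WalkingParallelPair.one⟩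

lemma TopModuleCat.surjective_of_isColimit {M N P : TopModuleCat R} {f : M ⟶ N} {p : N ⟶ P}
    {w : f ≫ p = 0} (h : IsColimit (CokernelCofork.ofπ p w)) : Function.Surjective p := by
  obtain ⟨e, he⟩ := exists_iso_coker h
  have : p = cokerπ f ≫ e.inv := by rw [← he, Category.assoc, e.hom_inv_id, Category.comp_id]
  intro x
  obtain ⟨y, hy⟩ := cokerπ_surjective f (e.hom x)
  refine ⟨y, ?_⟩
  rw [this, ConcreteCategory.comp_apply]
  have h2 : e.inv (e.hom x) = x := by
    rw [← ConcreteCategory.comp_apply, e.hom_inv_id, ConcreteCategory.id_apply]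
  exact (congrArg e.inv hy).trans h2

lemma TopModuleCat.eq_zero_iff_of_isColimit {M N P : TopModuleCat R} {f : M ⟶ N} {p : N ⟶ P}
    {w : f ≫ p = 0} (h : IsColimit (CokernelCofork.ofπ p w)) {x : N} :
    p x = 0 ↔ ∃ y, f y = x := by
  obtain ⟨e, he⟩ := exists_iso_coker h
  constructor
  · intro hx
    have h0 : cokerπ f x = 0 := by
      rw [← he, ConcreteCategory.comp_apply, hx, map_zero]
    exact (Submodule.Quotient.mk_eq_zero _).1 h0
  · rintro ⟨y, rfl⟩
    rw [← ConcreteCategory.comp_apply, w]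
    rfl

lemma TopModuleCat.injective_of_isLimit {M N P : TopModuleCat R} {i : P ⟶ M} {f : M ⟶ N}
    {w : i ≫ f = 0} (h : IsLimit (KernelFork.ofι i w)) : Function.Injective i := by
  let e : P ≅ TopModuleCat.ker f := h.conePointUniqueUpToIso (TopModuleCat.isLimitKer f)
  have he : e.hom ≫ TopModuleCat.kerι f = i :=
    h.conePointUniqueUpToIso_hom_comp (TopModuleCat.isLimitKer f) WalkingParallelPair.zero
  intro x y hxy
  rw [← he, ConcreteCategory.comp_apply, ConcreteCategory.comp_apply] at hxy
  have h1 : e.hom x = e.hom y := Subtype.val_injective hxy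
  have h2 (x : P) : e.inv (e.hom x) = x := by
    rw [← ConcreteCategory.comp_apply, e.hom_inv_id, ConcreteCategory.id_apply]
  rw [← h2 x, h1, h2]

end Homology

namespace ContinuousCohomology

open TopRep ContRepresentation

variable {k : Type*} [Ring k] [TopologicalSpace k]
  {G : Type*} [Group G] [TopologicalSpace G] [IsTopologicalGroup G] (M : TopRep k G)

lemma π_surjective (n : ℕ) : Function.Surjective (π M n) :=
  TopModuleCat.surjective_of_isColimit ((homogeneousCochains M).sc n).homologyIsCokernel

lemma π_one_eq_zero_iff (z : cocycles M 1) :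
    π M 1 z = 0 ↔ ∃ f : (homogeneousCochains M).X 0,
      (homogeneousCochains M).d 0 1 f = (homogeneousCochains M).iCycles 1 z := by
  have hinj : Function.Injective ((homogeneousCochains M).iCycles 1) :=
    TopModuleCat.injective_of_isLimit ((homogeneousCochains M).cyclesIsKernel 1 2 (by simp))
  rw [TopModuleCat.eq_zero_iff_of_isColimit
    ((homogeneousCochains M).homologyIsCokernel 0 1 (by simp))]
  refine exists_congr fun f => ?_
  rw [← hinj.eq_iff, ← ConcreteCategory.comp_apply, HomologicalComplex.toCycles_i]

lemma d_zero_apply (f : (homogeneousCochains M).X 0) (x y : G) :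
    ((homogeneousCochains M).d 0 1 f).1 x y = f.1 y - f.1 x :=
  congr(($(homogeneousCochains.d_apply M 0 f) : C(G, C(G, M))) x y)

lemma cocycle_apply (z : cocycles M 1) (x y w : G) :
    ((homogeneousCochains M).iCycles 1 z).1 x w = ((homogeneousCochains M).iCycles 1 z).1 x y
      + ((homogeneousCochains M).iCycles 1 z).1 y w := by
  set c := (homogeneousCochains M).iCycles 1 z with hc
  have h0 : (homogeneousCochains M).d 1 2 c = 0 := by
    rw [hc, ← ConcreteCategory.comp_apply, HomologicalComplex.iCycles_d]
    rfl
  have h1 : ((homogeneousCochains M).d 1 2 c).1 x y w = c.1 y w - (c.1 x w - c.1 x y) :=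
    congr(($(homogeneousCochains.d_apply M 1 c) : C(G, C(G, C(G, M)))) x y w)
  rw [h0] at h1
  have h2 : (0 : M) = c.1 y w - (c.1 x w - c.1 x y) := h1
  rw [eq_comm, sub_eq_zero] at h2
  rw [h2, add_sub_cancel]

lemma cochain_one_apply_mul (z : (homogeneousCochains M).X 1) (g x y : G) :
    z.1 (g * x) (g * y) = M.ρ g (z.1 x y) := by
  have h : M.ρ g (z.1 (g⁻¹ * (g * x)) (g⁻¹ * (g * y))) = z.1 (g * x) (g * y) :=
    congr(($(z.2 g) : C(G, C(G, M))) (g * x) (g * y))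
  rw [← h, inv_mul_cancel_left, inv_mul_cancel_left]

lemma cochain_zero_apply_mul (z : (homogeneousCochains M).X 0) (g x : G) :
    z.1 (g * x) = M.ρ g (z.1 x) := by
  have h : M.ρ g (z.1 (g⁻¹ * (g * x))) = z.1 (g * x) :=
    congr(($(z.2 g) : C(G, M)) (g * x))
  rw [← h, inv_mul_cancel_left]

end ContinuousCohomology

namespace ContinuousCohomology

open TopRep ContRepresentation

universe v

variable {k : Type u} [Ring k] [TopologicalSpace k]
  {G : Type v} [Group G] [TopologicalSpace G] [IsTopologicalGroup G] (M : TopRep k G)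

/-- A class in `H¹(G, M)` vanishes if it does so in `H¹(H, M)` for some `H → G` whose image
meets all cosets of a small neighbourhood of `1`. -/
theorem exists_nhds_one_forall_eq_zero_of_map_eq_zero [DiscreteTopology M] [Module.Finite ℤ M]
    (hM : Continuous fun p : G × M => M.ρ p.1 p.2) (α : continuousCohomology 1 M) :
    ∃ U ∈ 𝓝 (1 : G), ∀ (H : Type v) [Group H] [TopologicalSpace H] [IsTopologicalGroup H]
      (φ : H →ₜ* G), (∀ g, ∃ h, ∃ u ∈ U, g = φ h * u) →
      map φ (𝟙 (res (φ : H →* G) M)) 1 α = 0 → α = 0 := by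
  obtain ⟨z, rfl⟩ := π_surjective M 1 α
  set c := (homogeneousCochains M).iCycles 1 z with hc
  have hcoc (x y w : G) : c.1 x w = c.1 x y + c.1 y w := cocycle_apply M z x y w
  have hc1 (x : G) : c.1 x x = 0 := by simpa using hcoc x x x
  obtain ⟨s, hs⟩ := Module.Finite.fg_top (R := ℤ) (M := M)
  have hcont (m : M) : Continuous fun g : G => M.ρ g m := 
    hM.comp (Continuous.prodMk continuous_id continuous_const)
  have hU1 : {g : G | c.1 1 g = 0} ∈ 𝓝 (1 : G) :=
    (c.1 1 : C(G, M)).continuous.continuousAt.preimage_mem_nhds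
      (t := {0}) (by rw [nhds_discrete]; exact hc1 1)
  have hU2 (m : M) : {g : G | M.ρ g m = m} ∈ 𝓝 (1 : G) :=
    (hcont m).continuousAt.preimage_mem_nhds
      (t := {m}) (by rw [nhds_discrete]; simp)
  -- On this neighbourhood the cocycle vanishes and the generators of `M`, hence all of `M`, are
  -- fixed.
  refine ⟨{g | c.1 1 g = 0} ∩ ⋂ m ∈ s, {g | M.ρ g m = m},
    Filter.inter_mem hU1 ((Filter.biInter_finset_mem s).2 fun m _ => hU2 m), ?_⟩
  intro H _ _ _ φ hφ hα
  have hρ (u : G) (hu : u ∈ ⋂ m ∈ s, {g | M.ρ g m = m}) (m : M) : M.ρ u m = m := by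
    have hm : m ∈ Submodule.span ℤ (s : Set M) := hs ▸ Submodule.mem_top
    induction hm using Submodule.span_induction with
    | mem x hx => exact Set.mem_iInter₂.1 hu x hx
    | zero => exact map_zero _
    | add x y _ _ hx hy => rw [map_add, hx, hy]
    | smul a x _ hx => rw [map_zsmul, hx]
  rw [← ConcreteCategory.comp_apply, π_map, ConcreteCategory.comp_apply, π_one_eq_zero_iff] at hα
  obtain ⟨f, hf⟩ := hα
  rw [← ConcreteCategory.comp_apply, HomologicalComplex.cyclesMap_i,
    ConcreteCategory.comp_apply, ← hc] at hf
  have hf' (h : H) : f.1 h - f.1 1 = c.1 1 (φ h) := by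
    rw [← d_zero_apply, hf, ← map_one φ]
    rfl
  let m : M := f.1 1
  have hfm (h : H) : f.1 h = M.ρ (φ h) m := by
    have := cochain_zero_apply_mul _ f h 1
    rwa [mul_one] at this
  have hmul (g x y : G) : c.1 (g * x) (g * y) = M.ρ g (c.1 x y) := cochain_one_apply_mul M c g x y
  -- For `g = φ h * u`, the cocycle relation gives `c(1, g) = c(1, φ h) + φ h • c(1, u)`. The second
  -- term is zero, and the first is `φ h • m - m = g • m - m` because `u` fixes `m`.
  have key (g : G) : c.1 1 g = M.ρ g m - m := by
    obtain ⟨h, u, hu, rfl⟩ := hφ g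
    have h1 := hmul (φ h) 1 u
    rw [mul_one, hu.1, map_zero] at h1
    rw [hcoc 1 (φ h), ← hf', hfm, h1, add_zero, map_mul, mul_apply_eq_comp, hρ u hu.2]
  rw [π_one_eq_zero_iff, ← hc]
  refine ⟨⟨(⟨fun g => M.ρ g m, hcont m⟩ : C(G, M)), fun g => ?_⟩, ?_⟩
  · refine ContinuousMap.ext fun x => ?_
    change M.ρ g (M.ρ (g⁻¹ * x) m) = M.ρ x m
    rw [← mul_apply_eq_comp, ← map_mul, mul_inv_cancel_left]
  · refine Subtype.ext (ContinuousMap.ext fun x => ContinuousMap.ext fun y => ?_)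
    refine (d_zero_apply M _ x y).trans ?_
    change M.ρ y m - M.ρ x m = c.1 x y
    have h1 := hmul x 1 (x⁻¹ * y)
    rw [mul_one, mul_inv_cancel_left, key, map_sub] at h1
    rw [h1, ← mul_apply_eq_comp, ← map_mul, mul_inv_cancel_left]

end ContinuousCohomology

end

/-! ### Restriction to extensions linearly disjoint from a finite extension -/

section

open Topology
open Polynomial

namespace TateShafarevich

variable {K : Type u} [Field K]

/-- The field `E` is fixed before its generator `θ`, so that the primitive element can be chosen
later to suit the curve. -/
lemma exists_fixing_subset_of_mem_nhds_one {U : Set (absoluteGaloisGroup K)} (hU : U ∈ 𝓝 1) :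
    ∃ E : IntermediateField K (AlgebraicClosure K), FiniteDimensional K E ∧
      ∀ θ, E = IntermediateField.adjoin K {θ} →
        ∀ g : absoluteGaloisGroup K, toAut g θ = θ → g ∈ U := by
  obtain ⟨E, hE, hEU⟩ := (krullTopology_mem_nhds_one_iff K (AlgebraicClosure K) U).1 hU
  refine ⟨E, hE, fun θ hθ g hg => hEU ((IntermediateField.mem_fixingSubgroup_iff _ _).2
    fun x hx => ?_)⟩
  rw [hθ] at hx
  exact (IntermediateField.forall_mem_adjoin_smul_eq_self_iff (F := K)
    (S := {θ}) (toAut g)).2 (by simpa using hg) x hx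

/-- Both `θ` and `g θ` map to roots of the same irreducible polynomial over `L`, so some `h` in
`Gal(L)` carries one to the other. Then `(galRes K L h)⁻¹ * g` fixes `θ`. -/
lemma exists_eq_galRes_mul {L : Type u} [Field L] [Algebra K L] {U : Set (absoluteGaloisGroup K)}
    {θ : AlgebraicClosure K} (hθ : ∀ g : absoluteGaloisGroup K, toAut g θ = θ → g ∈ U)
    (hirr : Irreducible ((minpoly K θ).map (algebraMap K L))) (g : absoluteGaloisGroup K) :
    ∃ h : absoluteGaloisGroup L, ∃ u ∈ U, g = galRes K L h * u := by
  let ι : AlgebraicClosure K →ₐ[K] AlgebraicClosure L := IsAlgClosed.lift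
  have hm : ((minpoly K θ).map (algebraMap K L)).Monic :=
    (minpoly.monic (Algebra.IsIntegral.isIntegral θ)).map _
  have hroot (x : AlgebraicClosure K) (hx : aeval x (minpoly K θ) = 0) :
      aeval (ι x) ((minpoly K θ).map (algebraMap K L)) = 0 := by
    rw [aeval_map_algebraMap, aeval_algHom_apply, hx, map_zero]
  have h1 := minpoly.eq_of_irreducible_of_monic hirr (hroot θ (minpoly.aeval K θ)) hm
  have h2 := minpoly.eq_of_irreducible_of_monic hirr
    (hroot (toAut g θ) (by rw [aeval_algHom_apply, minpoly.aeval, map_zero])) hm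
  obtain ⟨h, hh⟩ := (isConjRoot_iff_exists_algEquiv (K := L)).1 (show IsConjRoot L (ι (toAut g θ)) (ι θ) from h2.symm.trans h1)
  let h' : absoluteGaloisGroup L := toAut.symm h
  refine ⟨h', (galRes K L h')⁻¹ * g, hθ _ ?_, by group⟩
  rw [map_mul, map_inv, AlgEquiv.mul_apply, AlgEquiv.aut_inv, AlgEquiv.symm_apply_eq]
  refine ι.injective ?_
  exact hh.symm.trans (restrictAut_spec ι h' θ).symm

/-- A class in `H¹(K, M)` vanishes if it does so over an extension of `K` over which the minimal
polynomial of a primitive element of a suitable finite extension of `K` stays irreducible. -/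
theorem exists_forall_eq_zero_of_resH_eq_zero
    (M : TopRep.{u} ℤ (absoluteGaloisGroup K)) [DiscreteTopology M] [Module.Finite ℤ M]
    (hM : Continuous fun p : absoluteGaloisGroup K × M => M.ρ p.1 p.2)
    (α : continuousCohomology 1 M) :
    ∃ E : IntermediateField K (AlgebraicClosure K), FiniteDimensional K E ∧
      ∀ (pb : PowerBasis K E) (L : Type u) [Field L] [Algebra K L],
        Irreducible ((minpoly K pb.gen).map (algebraMap K L)) → resH L 1 M α = 0 → α = 0 := by
  obtain ⟨U, hU, h⟩ :=
    ContinuousCohomology.exists_nhds_one_forall_eq_zero_of_map_eq_zero M hM α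
  obtain ⟨E, hE, hEU⟩ := exists_fixing_subset_of_mem_nhds_one hU
  refine ⟨E, hE, fun pb L _ _ hirr => h _ (galRes K L) (exists_eq_galRes_mul
    (hEU (pb.gen : AlgebraicClosure K) ?_) (by rwa [IntermediateField.minpoly_eq] at hirr))⟩
  have htop : IntermediateField.adjoin K {pb.gen} = ⊤ :=
    IntermediateField.adjoin_eq_top_of_algebra K _ pb.adjoin_gen_eq_top
  have := congrArg (IntermediateField.map E.val) htop
  rw [IntermediateField.adjoin_map, Set.image_singleton] at this
  exact (E.fieldRange_val.symm.trans (AlgHom.fieldRange_eq_map _)).trans this.symm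

end TateShafarevich

end

/-! ### Irreducibility over the completion by approximation -/

section

open Polynomial

section ValuationCoefficients

variable {K Γ : Type*} [Field K] [LinearOrderedCommGroupWithZero Γ] (v : Valuation K Γ)

lemma Valuation.coeff_mul_lt_one {p q : K[X]} (hp : ∀ i, v (p.coeff i) < 1)
    (hq : ∀ i, v (q.coeff i) ≤ 1) (i : ℕ) : v ((p * q).coeff i) < 1 := by
  rw [coeff_mul]
  refine v.map_sum_lt one_ne_zero fun x _ => ?_
  rw [map_mul]
  exact mul_lt_one_of_lt_of_le (hp _) (hq _)

lemma Valuation.coeff_le_one_of_dvd {p q : K[X]} (hp : p.Monic) (hq : q.Monic)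
    (hpi : ∀ i, v (p.coeff i) ≤ 1) (hqp : q ∣ p) (i : ℕ) : v (q.coeff i) ≤ 1 := by
  obtain ⟨P, hP⟩ : ∃ P : v.valuationSubring[X], P.map (algebraMap _ K) = p := by
    rw [← mem_lifts, lifts_iff_coeff_lifts]
    exact fun n => ⟨⟨p.coeff n, hpi n⟩, rfl⟩
  have hPm : P.Monic := by
    refine monic_of_injective (f := algebraMap v.valuationSubring K) Subtype.val_injective ?_
    rwa [hP]
  obtain ⟨Q, hQ⟩ := IsIntegrallyClosed.eq_map_mul_C_of_dvd K hPm (hP ▸ hqp)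
  rw [hq.leadingCoeff, C_1, mul_one] at hQ
  rw [← hQ, coeff_map]
  exact (Q.coeff i).2

lemma Polynomial.exists_monic_valuation_coeff_sub_lt_one {F : Type*} [Field F] [Algebra F K]
    (hd : ∀ x : K, ∃ a : F, v (x - algebraMap F K a) < 1) {p : K[X]} (hp : p.Monic) :
    ∃ q : F[X], q.Monic ∧ q.natDegree = p.natDegree ∧
      ∀ i, v ((p - q.map (algebraMap F K)).coeff i) < 1 := by
  choose a ha using hd
  let r : F[X] := ∑ i ∈ Finset.range p.natDegree, C (a (p.coeff i)) * X ^ i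
  have hr : r.degree < p.natDegree := by
    refine (degree_sum_le _ _).trans_lt ((Finset.sup_lt_iff (WithBot.bot_lt_coe _)).2 fun i hi => ?_)
    exact (degree_C_mul_X_pow_le _ _).trans_lt (by exact_mod_cast Finset.mem_range.1 hi)
  refine ⟨X ^ p.natDegree + r, monic_X_pow_add hr, ?_, fun i => ?_⟩
  · rw [natDegree_add_eq_left_of_degree_lt (by rwa [degree_X_pow]), natDegree_X_pow]
  · have hri : r.coeff i = if i < p.natDegree then a (p.coeff i) else 0 := by
      simp [r, coeff_X_pow]
    rw [coeff_sub, coeff_map, coeff_add, coeff_X_pow, hri]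
    rcases lt_trichotomy i p.natDegree with h | rfl | h
    · simpa [h, h.ne] using ha (p.coeff i)
    · simp [hp.coeff_natDegree]
    · simp [h.ne', h.not_gt, coeff_eq_zero_of_natDegree_lt h]

end ValuationCoefficients

section Irreducible

variable {K L Γ : Type*} [Field K] [Field L] [Algebra K L] [LinearOrderedCommGroupWithZero Γ]

/-- Up to sign, the lower coefficients are the coordinates of `θ ^ dim`, an element with `w` at most
`1`. -/
lemma PowerBasis.valuation_coeff_minpoly_le_one {v : Valuation K Γ} {w : Valuation L Γ}
    (pb : PowerBasis K L) (hθ : w pb.gen ≤ 1) (hw : ∀ x i, v (pb.basis.repr x i) ≤ w x) (i : ℕ) :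
    v ((minpoly K pb.gen).coeff i) ≤ 1 := by
  have hm := minpoly.monic pb.isIntegral_gen
  rcases lt_trichotomy i pb.dim with h | rfl | h
  · have h1 : ((X : K[X]) ^ pb.dim - minpoly K pb.gen).natDegree < pb.dim :=
      IsMonicOfDegree.natDegree_sub_lt pb.dim_pos.ne' (isMonicOfDegree_X_pow K pb.dim)
        ⟨pb.natDegree_minpoly, hm⟩
    have h2 := hw (pb.gen ^ pb.dim) ⟨i, h⟩
    have h3 : pb.gen ^ pb.dim = aeval pb.gen ((X : K[X]) ^ pb.dim - minpoly K pb.gen) := by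
      simp
    replace h2 := h2.trans ((w.map_pow _ _).trans_le (pow_le_one₀ zero_le hθ))
    rw [h3, pb.repr_aeval h1, coeff_sub, coeff_X_pow, if_neg h.ne, zero_sub, v.map_neg] at h2
    exact h2
  · rw [← pb.natDegree_minpoly, hm.coeff_natDegree, map_one]
  · rw [coeff_eq_zero_of_natDegree_lt (by rwa [pb.natDegree_minpoly]), map_zero]
    exact zero_le_one

/-- Let `w` be a valuation on `L = K(θ)` which is the maximum of the valuations of the coordinates.
Then the minimal polynomial of `θ` stays irreducible over valued fields in which `K` is dense. -/
theorem PowerBasis.irreducible_map_minpoly_of_valuation_repr_le {v : Valuation K Γ}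
    {w : Valuation L Γ} (pb : PowerBasis K L) (hvw : ∀ x, w (algebraMap K L x) = v x)
    (hθ : w pb.gen ≤ 1) (hw : ∀ x i, v (pb.basis.repr x i) ≤ w x)
    {F : Type*} [Field F] [Algebra K F] (vF : Valuation F Γ)
    (hvF : ∀ x, vF (algebraMap K F x) = v x) (hd : ∀ x : F, ∃ a : K, vF (x - algebraMap K F a) < 1) :
    Irreducible ((minpoly K pb.gen).map (algebraMap K F)) := by
  have hm := minpoly.monic pb.isIntegral_gen
  have hint (i) : vF (((minpoly K pb.gen).map (algebraMap K F)).coeff i) ≤ 1 := by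
    rw [coeff_map, hvF]
    exact pb.valuation_coeff_minpoly_le_one hθ hw i
  have hdim : ((minpoly K pb.gen).map (algebraMap K F)).natDegree = pb.dim := by
    rw [hm.natDegree_map, pb.natDegree_minpoly]
  have hne : (minpoly K pb.gen).map (algebraMap K F) ≠ 1 := fun h => by
    rw [h, natDegree_one] at hdim
    exact pb.dim_pos.ne hdim
  refine ((hm.map _).irreducible_iff_natDegree.2 ⟨hne, fun p q hp hq hpq => ?_⟩)
  by_contra! h
  have hdeg : p.natDegree + q.natDegree = pb.dim := by rw [← hp.natDegree_mul hq, hpq, hdim]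
  -- A factorisation over `F` is approximated by monic `p'`, `q'` over `K` modulo elements of
  -- valuation below `1`. Then `p'(θ) * q'(θ)` has `w` below `1`, as it agrees with the value of the
  -- minimal polynomial at `θ` up to such an error.
  obtain ⟨p', hp', hpd, hpp⟩ := exists_monic_valuation_coeff_sub_lt_one vF hd hp
  obtain ⟨q', hq', hqd, hqq⟩ := exists_monic_valuation_coeff_sub_lt_one vF hd hq
  have hpi := vF.coeff_le_one_of_dvd (hm.map _) hp hint ⟨q, hpq.symm⟩
  have hqi := vF.coeff_le_one_of_dvd (hm.map _) hq hint ⟨p, by rw [mul_comm, hpq]⟩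
  have hp'i (i) : vF ((p'.map (algebraMap K F)).coeff i) ≤ 1 := by
    have : p'.map (algebraMap K F) = p - (p - p'.map (algebraMap K F)) := by ring
    rw [this, coeff_sub]
    exact (vF.map_sub _ _).trans (max_le (hpi i) (hpp i).le)
  have hlt (i) : v ((minpoly K pb.gen - p' * q').coeff i) < 1 := by
    rw [← hvF, ← coeff_map, Polynomial.map_sub, Polynomial.map_mul, ← hpq]
    have : p * q - p'.map (algebraMap K F) * q'.map (algebraMap K F) =
        (p - p'.map (algebraMap K F)) * q +
          (q - q'.map (algebraMap K F)) * p'.map (algebraMap K F) := by ring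
    rw [this, coeff_add]
    exact vF.map_add_lt (vF.coeff_mul_lt_one hpp hqi i) (vF.coeff_mul_lt_one hqq hp'i i)
  have hwlt : w (aeval pb.gen (minpoly K pb.gen - p' * q')) < 1 := by
    rw [aeval_eq_sum_range]
    refine w.map_sum_lt one_ne_zero fun i _ => ?_
    rw [Algebra.smul_def, map_mul, hvw, map_pow]
    exact mul_lt_one_of_lt_of_le (hlt i) (pow_le_one₀ zero_le hθ)
  -- The leading coefficient `1` is one of the coordinates of `r(θ)`.
  have hge {r : K[X]} (hr : r.Monic) (hrd : r.natDegree < pb.dim) : 1 ≤ w (aeval pb.gen r) := by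
    have := hw (aeval pb.gen r) ⟨_, hrd⟩
    rwa [pb.repr_aeval hrd, hr.coeff_natDegree, map_one] at this
  rw [map_sub, minpoly.aeval, zero_sub, w.map_neg, map_mul, map_mul] at hwlt
  exact hwlt.not_ge (one_le_mul (hge hp' (by omega)) (hge hq' (by omega)))

end Irreducible


lemma Valuation.exists_sub_coe_lt_one {K Γ : Type*} [Field K]
    [LinearOrderedCommGroupWithZero Γ] (v : Valuation K Γ) (x : v.Completion) :
    ∃ a : WithVal v, Valued.v (x - (a : v.Completion)) < 1 := by
  have h : {y : v.Completion | Valued.v (y - x) < 1} ∈ nhds x := by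
    rw [Valued.mem_nhds]
    refine ⟨1, fun y hy => ?_⟩
    rw [Set.mem_ofPred_eq, Valuation.restrict_lt_iff_lt_embedding, Units.val_one, map_one] at hy
    exact hy
  obtain ⟨a, ha⟩ := UniformSpace.Completion.denseRange_coe.mem_nhds h
  exact ⟨a, by rw [Valuation.map_sub_swap]; exact ha⟩

namespace TateShafarevich

lemma exists_valuation_completedField {K : Type*} [Field K] (v : Valuation K ℤᵐ⁰) :
    ∃ v' : Valuation (CompletedField v) ℤᵐ⁰,
      (∀ x, v' (algebraMap K (CompletedField v) x) = v x) ∧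
      ∀ x, ∃ a : K, v' (x - algebraMap K (CompletedField v) a) < 1 :=
  ⟨(Valued.v : Valuation v.Completion ℤᵐ⁰),
    fun x => Valued.valuedCompletion_apply (WithVal.toVal v x),
    fun x => (Valuation.exists_sub_coe_lt_one v x).imp' WithVal.ofVal fun _ h => h⟩

end TateShafarevich

end

/-! ### The valuation at a rational point of the affine line -/

section

open Polynomial

section ValuationAt

variable {F : Type*} [Field F] (E : Type*) [Field E] [Algebra F[X] E]

/-- The order of vanishing at a rational point of the affine line. -/
lemma exists_valuation_eval [IsFractionRing F[X] E] (a : F) : ∃ v : Valuation E ℤᵐ⁰, Function.Surjective v ∧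
    (∀ p : F[X], v (algebraMap F[X] E p) ≤ 1) ∧
    (∀ p : F[X], v (algebraMap F[X] E p) < 1 ↔ p.eval a = 0) ∧
    ∀ x, v x ≤ 1 → ∃ p q : F[X], q.eval a ≠ 0 ∧
      algebraMap F[X] E q * x = algebraMap F[X] E p := by
  let P : IsDedekindDomain.HeightOneSpectrum F[X] :=
    { asIdeal := Ideal.span {X - C a}
      isPrime := (Ideal.span_singleton_prime (X_sub_C_ne_zero a)).2 (prime_X_sub_C a)
      ne_bot := by simpa using X_sub_C_ne_zero a }
  have hlt (p : F[X]) : P.valuation E (algebraMap F[X] E p) < 1 ↔ p.eval a = 0 := by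
    rw [P.valuation_lt_one_iff_mem, Ideal.mem_span_singleton, dvd_iff_isRoot, IsRoot]
  refine ⟨P.valuation E, P.valuation_surjective E, P.valuation_le_one, hlt, fun x hx => ?_⟩
  -- In lowest terms the denominator cannot vanish at `a`: as `x` is integral there, the numerator
  -- would vanish too.
  obtain ⟨p, q, hpq, rfl⟩ := IsFractionRing.exists_reduced_fraction (A := F[X]) x
  refine ⟨p, q, fun hq => ?_, by rw [mul_comm, IsLocalization.mk'_spec]⟩
  have h1 := (hlt q).2 hq
  have h2 : P.valuation E (algebraMap F[X] E p) < 1 := by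
    rw [← IsLocalization.mk'_spec E p q, map_mul, mul_comm]
    exact mul_lt_one_of_lt_of_le h1 hx
  rw [hlt] at h2
  exact not_isUnit_X_sub_C a (hpq (dvd_iff_isRoot.2 h2) (dvd_iff_isRoot.2 hq))

variable {E} {v : Valuation E ℤᵐ⁰} {a : F} (h1 : ∀ p : F[X], v (algebraMap F[X] E p) ≤ 1)

/-- Polynomials are integral at a point of the affine line. -/
noncomputable def polynomialToValuationSubring : F[X] →+* v.valuationSubring :=
  (algebraMap F[X] E).codRestrict v.valuationSubring h1

lemma residue_polynomialToValuationSubring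
    (h2 : ∀ p : F[X], v (algebraMap F[X] E p) < 1 ↔ p.eval a = 0) (p : F[X]) :
    IsLocalRing.residue _ (polynomialToValuationSubring h1 p) =
      IsLocalRing.residue _ (polynomialToValuationSubring h1 (C (p.eval a))) := by
  rw [← sub_eq_zero, ← map_sub, ← map_sub, IsLocalRing.residue_eq_zero_iff,
    Valuation.mem_maximalIdeal_iff]
  exact (h2 _).2 (by simp)

lemma residue_constants_surjective
    (h2 : ∀ p : F[X], v (algebraMap F[X] E p) < 1 ↔ p.eval a = 0)
    (h3 : ∀ x, v x ≤ 1 → ∃ p q : F[X], q.eval a ≠ 0 ∧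
      algebraMap F[X] E q * x = algebraMap F[X] E p) :
    Function.Surjective ((IsLocalRing.residue v.valuationSubring).comp
      ((polynomialToValuationSubring h1).comp C)) := by
  intro y
  obtain ⟨x, rfl⟩ := IsLocalRing.residue_surjective y
  obtain ⟨p, q, hq, hpq⟩ := h3 x x.2
  have hpq' : polynomialToValuationSubring h1 q * x = polynomialToValuationSubring h1 p :=
    Subtype.ext hpq
  have h := congrArg (IsLocalRing.residue _) hpq'
  rw [map_mul, residue_polynomialToValuationSubring h1 h2 p,
    residue_polynomialToValuationSubring h1 h2 q] at h
  refine ⟨p.eval a / q.eval a, ?_⟩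
  rw [map_div₀, div_eq_iff ((_root_.map_ne_zero _).2 hq), mul_comm]
  exact h.symm

/-- The constants `F` map isomorphically onto the residue field, and this turns evaluation at `a`
into reduction. -/
lemma irreducible_map_residue
    (h2 : ∀ p : F[X], v (algebraMap F[X] E p) < 1 ↔ p.eval a = 0)
    (h3 : ∀ x, v x ≤ 1 → ∃ p q : F[X], q.eval a ≠ 0 ∧
      algebraMap F[X] E q * x = algebraMap F[X] E p)
    {f : F[X][X]} (hf : Irreducible (f.map (evalRingHom a))) :
    Irreducible ((f.map (polynomialToValuationSubring h1)).map
      (IsLocalRing.residue v.valuationSubring)) := by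
  let e := RingEquiv.ofBijective _
    ⟨RingHom.injective _, residue_constants_surjective h1 h2 h3⟩
  have : (f.map (polynomialToValuationSubring h1)).map (IsLocalRing.residue v.valuationSubring) =
      mapEquiv e (f.map (evalRingHom a)) := by
    rw [mapEquiv_apply, map_map, map_map]
    congr 1
    ext p
    · exact congrArg (fun q : F[X] => IsLocalRing.residue _ (polynomialToValuationSubring h1 q))
        (congrArg C (eval_C (x := a)).symm)
    · exact residue_polynomialToValuationSubring h1 h2 X
  rw [this, MulEquiv.irreducible_iff]
  exact hf

end ValuationAt

end

/-! ### Integral elements and centres of the Gauss valuation -/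

section

open Polynomial

section GaussValuationIntegers

variable {E L Γ : Type*} [Field E] [Field L] [Algebra E L] [LinearOrderedCommGroupWithZero Γ]
  {v : Valuation E Γ} {pb : PowerBasis E L} {F : v.valuationSubring[X]}
  (hF : F.map (algebraMap _ E) = minpoly E pb.gen)
  (hirr : Irreducible (F.map (IsLocalRing.residue v.valuationSubring)))

lemma gaussValuation_algebraMap (e : E) : gaussValuation hF hirr (algebraMap E L e) = v e := by
  change gaussValue v pb _ = _
  rw [Algebra.algebraMap_eq_smul_one, gaussValue_smul, gaussValue_one, mul_one]

lemma gaussValuation_le_one_iff (x : L) :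
    gaussValuation hF hirr x ≤ 1 ↔ ∀ i, v (pb.basis.repr x i) ≤ 1 :=
  gaussValue_le_iff

lemma gaussValuation_gen_le_one : gaussValuation hF hirr pb.gen ≤ 1 := by
  have := gaussValue_aeval_le_one hF X
  rwa [map_X, aeval_X] at this

lemma isIntegral_of_gaussValuation_le_one {x : L} (hx : gaussValuation hF hirr x ≤ 1) :
    IsIntegral v.valuationSubring x := by
  rw [gaussValuation_le_one_iff] at hx
  have hgen : IsIntegral v.valuationSubring pb.gen :=
    ⟨F, monic_of_map_eq_minpoly hF, by
      rw [IsScalarTower.algebraMap_eq v.valuationSubring E L, ← eval₂_map, hF]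
      exact minpoly.aeval E pb.gen⟩
  rw [← pb.basis.sum_repr x]
  refine IsIntegral.sum _ fun i _ => ?_
  rw [pb.basis_eq_pow]
  exact (hgen.pow i).smul (⟨_, hx i⟩ : v.valuationSubring)

end GaussValuationIntegers

/-- The residue field of `w` is integral over that of `v`, hence over `k`. So `R` maps to it by an
integral homomorphism, whose kernel is therefore maximal. -/
lemma Valuation.isMaximal_comap_of_isIntegral {k E L R Γ : Type*} [Field k] [Field E] [Field L]
    [Algebra E L] [CommRing R] [LinearOrderedCommGroupWithZero Γ] {v : Valuation E Γ}
    {w : Valuation L Γ} (hvw : ∀ x, w (algebraMap E L x) = v x)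
    (hw : ∀ x, w x ≤ 1 → IsIntegral v.valuationSubring x) (j : k →+* v.valuationSubring)
    (hj : Function.Surjective ((IsLocalRing.residue v.valuationSubring).comp j))
    (i : k →+* R) (g : R →+* w.valuationSubring)
    (hij : ∀ a, (g (i a) : L) = algebraMap E L (j a)) :
    ((IsLocalRing.maximalIdeal w.valuationSubring).comap g).IsMaximal := by
  have : v.HasExtension w := ⟨fun x y => by simp [hvw]⟩
  let a := algebraMap v.valuationSubring w.valuationSubring
  have ha : a.IsIntegral := fun x =>
    (isIntegral_algebraMap_iff (A := w.valuationSubring) (B := L) Subtype.val_injective).1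
      (hw x x.2)
  have h1 : (IsLocalRing.ResidueField.map a).IsIntegral := by
    refine RingHom.IsIntegral.tower_top (IsLocalRing.residue _) _ ?_
    rw [IsLocalRing.ResidueField.map_comp_residue]
    exact ha.trans _ _ (RingHom.isIntegral_of_surjective _ IsLocalRing.residue_surjective)
  have h2 := RingHom.IsIntegral.trans _ _ (RingHom.isIntegral_of_surjective _ hj) h1
  have h3 : ((IsLocalRing.residue _).comp g).IsIntegral := by
    refine RingHom.IsIntegral.tower_top i _ ?_
    convert h2 using 1
    refine RingHom.ext fun x => congrArg (IsLocalRing.residue w.valuationSubring) ?_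
    exact Subtype.val_injective (hij x)
  have := Ideal.isMaximal_comap_of_isIntegral_of_isMaximal' _ h3 ⊥
  rwa [← Ideal.comap_comap, ← RingHom.ker_eq_comap_bot, IsLocalRing.ker_residue] at this

end

/-! ### From an irreducible specialisation to a closed point of the curve -/

section

open Polynomial

section ClosedPoint

variable {F R E K L : Type*} [Field F] [CommRing R] [Field E] [Field K] [Field L]
  [Algebra F[X] R] [Algebra F[X] E] [Algebra F[X] K] [Algebra F[X] L] [Algebra R K] [Algebra E K]
  [Algebra E L] [Algebra K L] [IsScalarTower F[X] R K] [IsScalarTower F[X] E K]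
  [IsScalarTower F[X] E L] [IsScalarTower E K L] [IsFractionRing F[X] E]

lemma PowerBasis.repr_eq_sum_smul_repr_pow (pE : PowerBasis E L) (pK : PowerBasis K L) (x : L)
    (j : Fin pK.dim) :
    pK.basis.repr x j =
      ∑ i : Fin pE.dim, algebraMap E K (pE.basis.repr x i) * pK.basis.repr (pE.gen ^ (i : ℕ)) j := by
  conv_lhs => rw [← pE.basis.sum_repr x]
  rw [map_sum, Finsupp.finsetSum_apply]
  refine Finset.sum_congr rfl fun i _ => ?_
  rw [pE.basis_eq_pow, ← IsScalarTower.algebraMap_smul K, map_smul, Finsupp.smul_apply,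
    smul_eq_mul]

/-- The valuation `w` is the Gauss valuation over the point `a` of the line, `v` is its restriction
to `K`, and `c` is its centre on `R`. As `D` is a unit at `a`, `R` is integral for `w` and the
`K`-coordinates of the powers of `θ` are integral. This compares coordinates over `K` with
coordinates over `E`, and identifies the valuation ring of `v` with the localisation of `R` at `c`.
-/
theorem exists_valuation_of_irreducible_eval (pE : PowerBasis E L) (pK : PowerBasis K L)
    (hgen : pK.gen = pE.gen) (hint : IsIntegral F[X] pE.gen) {a : F}
    (hirr : Irreducible ((minpoly F[X] pE.gen).map (evalRingHom a))) {D : F[X]} (hD : D.eval a ≠ 0)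
    {s : Set R} (hs : Algebra.adjoin F[X] s = ⊤)
    (hDs : ∀ r ∈ s, ∀ i, ∃ p : F[X], algebraMap F[X] E D *
      pE.basis.repr (algebraMap K L (algebraMap R K r)) i = algebraMap F[X] E p)
    (hDθ : ∀ (i : Fin pE.dim) (j : Fin pK.dim), ∃ r : R, algebraMap F[X] K D *
      pK.basis.repr (pE.gen ^ (i : ℕ)) j = algebraMap R K r) :
    ∃ (w : Valuation L ℤᵐ⁰) (v : Valuation K ℤᵐ⁰) (c : Ideal R), c.IsMaximal ∧
      Function.Surjective v ∧ (∀ x, w (algebraMap K L x) = v x) ∧ w pK.gen ≤ 1 ∧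
      (∀ x i, v (pK.basis.repr x i) ≤ w x) ∧
      ∀ x, v x ≤ 1 ↔ ∃ b d : R, d ∉ c ∧ algebraMap R K d * x = algebraMap R K b := by
  obtain ⟨v₀, hsurj, h1, h2, h3⟩ := exists_valuation_eval E a
  have hF : ((minpoly F[X] pE.gen).map (polynomialToValuationSubring h1)).map (algebraMap _ E) =
      minpoly E pE.gen := by
    rw [minpoly.isIntegrallyClosed_eq_field_fractions' E hint, map_map]
    rfl
  have hirr' := irreducible_map_residue h1 h2 h3 hirr
  set w := gaussValuation hF hirr' with hw
  have hwE (e : E) : w (algebraMap E L e) = v₀ e := gaussValuation_algebraMap hF hirr' e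
  have hwle (x : L) : w x ≤ 1 ↔ ∀ i, v₀ (pE.basis.repr x i) ≤ 1 :=
    gaussValuation_le_one_iff hF hirr' x
  have hwp (p : F[X]) : w (algebraMap K L (algebraMap R K (algebraMap F[X] R p))) =
      v₀ (algebraMap F[X] E p) := by
    rw [← IsScalarTower.algebraMap_apply F[X] R K, IsScalarTower.algebraMap_apply F[X] E K,
      ← IsScalarTower.algebraMap_apply E K L, hwE]
  have hv1 {p : F[X]} (hp : p.eval a ≠ 0) : v₀ (algebraMap F[X] E p) = 1 :=
    (h1 p).antisymm (not_lt.1 fun h => hp ((h2 p).1 h))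
  have hwR (r : R) : w (algebraMap K L (algebraMap R K r)) ≤ 1 := by
    have hr : r ∈ Algebra.adjoin F[X] s := hs ▸ Algebra.mem_top
    induction hr using Algebra.adjoin_induction with
    | mem r hr =>
      refine (hwle _).2 fun i => ?_
      obtain ⟨p, hp⟩ := hDs r hr i
      have := h1 p
      rwa [← hp, map_mul, hv1 hD, one_mul] at this
    | algebraMap p => exact (hwp p).trans_le (h1 p)
    | add x y _ _ hx hy =>
      rw [map_add, map_add]
      exact (w.map_add _ _).trans (max_le hx hy)
    | mul x y _ _ hx hy =>
      rw [map_mul, map_mul, map_mul]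
      exact mul_le_one' hx hy
  let g : R →+* w.valuationSubring :=
    ((algebraMap K L).comp (algebraMap R K)).codRestrict w.valuationSubring hwR
  have hmem (r : R) : r ∈ (IsLocalRing.maximalIdeal w.valuationSubring).comap g ↔
      w (algebraMap K L (algebraMap R K r)) < 1 := by
    rw [Ideal.mem_comap, Valuation.mem_maximalIdeal_iff]
    rfl
  have hcoef (i : Fin pE.dim) (j : Fin pK.dim) :
      w (algebraMap K L (pK.basis.repr (pE.gen ^ (i : ℕ)) j)) ≤ 1 := by
    obtain ⟨r, hr⟩ := hDθ i j
    have := hwR r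
    rwa [← hr, map_mul, map_mul, IsScalarTower.algebraMap_apply F[X] R K, hwp, hv1 hD,
      one_mul] at this
  refine ⟨w, w.comap (algebraMap K L), (IsLocalRing.maximalIdeal w.valuationSubring).comap g,
    ?_, ?_, fun _ => rfl, ?_, ?_, ?_⟩
  · exact Valuation.isMaximal_comap_of_isIntegral hwE
      (fun x hx => isIntegral_of_gaussValuation_le_one hF hirr' hx)
      ((polynomialToValuationSubring h1).comp C) (residue_constants_surjective h1 h2 h3)
      ((algebraMap F[X] R).comp C) g fun b => by
        change algebraMap K L (algebraMap R K (algebraMap F[X] R (C b))) =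
          algebraMap E L (algebraMap F[X] E (C b))
        rw [← IsScalarTower.algebraMap_apply F[X] R K, IsScalarTower.algebraMap_apply F[X] E K,
          ← IsScalarTower.algebraMap_apply E K L]
  · intro γ
    obtain ⟨e, rfl⟩ := hsurj γ
    refine ⟨algebraMap E K e, ?_⟩
    rw [Valuation.comap_apply, ← IsScalarTower.algebraMap_apply E K L, hwE]
  · rw [hgen]
    exact gaussValuation_gen_le_one hF hirr'
  · intro x j
    rw [Valuation.comap_apply, pE.repr_eq_sum_smul_repr_pow pK, map_sum]
    refine w.map_sum_le fun i _ => ?_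
    rw [map_mul, map_mul, ← IsScalarTower.algebraMap_apply E K L, hwE]
    exact (mul_le_of_le_one_right' (hcoef i j)).trans (gaussValue_le_iff.1 le_rfl i)
  · intro x
    rw [Valuation.comap_apply]
    constructor
    · intro hx
      -- Clear the `E`-coordinates of `x` by `Q` and the `K`-coordinates of the powers of `θ` by
      -- `D`. Both are nonzero at `a`, so `Q * D` lies outside `c`.
      choose p q hq hpq using fun i => h3 _ ((hwle _).1 hx i)
      let j₀ : Fin pK.dim := ⟨0, pK.dim_pos⟩
      choose r hr using fun i => hDθ i j₀
      let Q : F[X] := ∏ i, q i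
      have hQ (i) : ∃ m : F[X], algebraMap F[X] E Q *
          pE.basis.repr (algebraMap K L x) i = algebraMap F[X] E m := by
        obtain ⟨m, hm⟩ := Finset.dvd_prod_of_mem q (Finset.mem_univ i)
        refine ⟨m * p i, ?_⟩
        rw [show Q = q i * m from hm, map_mul, map_mul, ← hpq]
        ring
      choose m hm using hQ
      refine ⟨∑ i, algebraMap F[X] R (m i) * r i, algebraMap F[X] R (Q * D), ?_, ?_⟩
      · rw [hmem, hwp, hv1 (by simp [Q, eval_mul, eval_prod, hD, Finset.prod_ne_zero_iff, hq])]
        exact lt_irrefl _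
      -- An element of `K` is its own coordinate at `θ ^ 0`, and so is expressed through its
      -- `E`-coordinates.
      · have hx0 : x = pK.basis.repr (algebraMap K L x) j₀ := by
          have := pK.repr_aeval (p := C x) (by simpa using pK.dim_pos) j₀
          rwa [aeval_C, coeff_C_zero, eq_comm] at this
        conv_lhs => rw [hx0, pE.repr_eq_sum_smul_repr_pow pK]
        rw [Finset.mul_sum, map_sum]
        refine Finset.sum_congr rfl fun i _ => ?_
        rw [(algebraMap F[X] R).map_mul, (algebraMap R K).map_mul, (algebraMap R K).map_mul, ← hr,
          ← IsScalarTower.algebraMap_apply F[X] R K,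
          ← IsScalarTower.algebraMap_apply F[X] R K, ← IsScalarTower.algebraMap_apply F[X] R K,
          IsScalarTower.algebraMap_apply F[X] E K (m i), ← hm, (algebraMap E K).map_mul, ← IsScalarTower.algebraMap_apply F[X] E K]
        ring
    · rintro ⟨b, d, hd, hbd⟩
      rw [hmem, not_lt] at hd
      have := hwR b
      rw [← hbd, map_mul, map_mul, (hwR d).antisymm hd, one_mul] at this
      exact this

end ClosedPoint

end

/-! ### Denominators, and Hilbert irreducibility on a curve -/

section

open Polynomial

section

variable {A R K : Type*} [CommRing A] [CommRing R] [Field K] [Algebra A R] [Algebra A K]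
  [Algebra R K] [IsScalarTower A R K] [IsFractionRing R K]

/-- By algebraicity the denominator of `x` has a nonzero multiple in `A`. -/
lemma exists_algebraMap_mul_eq_algebraMap [Algebra.IsAlgebraic A R] (x : K) :
    ∃ d : A, d ≠ 0 ∧ ∃ r : R, algebraMap A K d * x = algebraMap R K r := by
  obtain ⟨a, b, hb, rfl⟩ := IsFractionRing.div_surjective R x
  obtain ⟨c, d, hd, h⟩ := (Algebra.IsAlgebraic.isAlgebraic (R := A) b).exists_smul_eq_mul a hb
  have := (algebraMap R K).domain_nontrivial
  have hb' : algebraMap R K b ≠ 0 := IsFractionRing.to_map_ne_zero_of_mem_nonZeroDivisors hb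
  refine ⟨d, hd, c, ?_⟩
  rw [← mul_div_assoc, div_eq_iff hb', IsScalarTower.algebraMap_apply A R K, ← map_mul, ← map_mul,
    ← Algebra.smul_def, h, mul_comm]

lemma exists_algebraMap_mul_eq_algebraMap_of_finite [IsDomain A] [Algebra.IsAlgebraic A R] {ι : Type*}
    [Finite ι] (x : ι → K) :
    ∃ d : A, d ≠ 0 ∧ ∀ i, ∃ r : R, algebraMap A K d * x i = algebraMap R K r := by
  have := Fintype.ofFinite ι
  choose d hd r hr using fun i => exists_algebraMap_mul_eq_algebraMap (A := A) (R := R) (x i)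
  refine ⟨∏ i, d i, Finset.prod_ne_zero_iff.2 fun i _ => hd i, fun i => ?_⟩
  obtain ⟨m, hm⟩ := Finset.dvd_prod_of_mem d (Finset.mem_univ i)
  refine ⟨algebraMap A R m * r i, ?_⟩
  rw [hm, map_mul, map_mul, ← hr, ← IsScalarTower.algebraMap_apply A R K]
  ring

lemma finiteDimensional_of_finiteType_of_isAlgebraic [IsDomain A] (E : Type*) [Field E] [Algebra A E]
    [IsFractionRing A E] [Algebra E K] [IsScalarTower A E K] [Algebra.FiniteType A R]
    [Algebra.IsAlgebraic A R] : FiniteDimensional E K := by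
  obtain ⟨s, hs⟩ := Algebra.FiniteType.out (R := A) (A := R)
  have h1 (r : R) : algebraMap R K r ∈ Algebra.adjoin E (algebraMap R K '' s) := by
    have hr : r ∈ Algebra.adjoin A (s : Set R) := hs ▸ Algebra.mem_top
    induction hr using Algebra.adjoin_induction with
    | mem r hr => exact Algebra.subset_adjoin ⟨r, hr, rfl⟩
    | algebraMap p =>
      rw [← IsScalarTower.algebraMap_apply A R K, IsScalarTower.algebraMap_apply A E K]
      exact Subalgebra.algebraMap_mem _ _
    | add x y _ _ hx hy => rw [map_add]; exact add_mem hx hy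
    | mul x y _ _ hx hy => rw [map_mul]; exact mul_mem hx hy
  have h2 : Algebra.FiniteType E K := by
    classical
    refine ⟨⟨s.image (algebraMap R K), ?_⟩⟩
    rw [Finset.coe_image, eq_top_iff]
    intro x _
    obtain ⟨d, hd, r, hr⟩ := exists_algebraMap_mul_eq_algebraMap (A := A) (R := R) x
    have hd' : algebraMap A E d ≠ 0 := by simpa using hd
    have : x = (algebraMap A E d)⁻¹ • algebraMap R K r := by
      rw [← hr, Algebra.smul_def, IsScalarTower.algebraMap_apply A E K, ← mul_assoc, ← map_mul,
        inv_mul_cancel₀ hd', map_one, one_mul]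
    rw [this]
    exact Subalgebra.smul_mem _ (h1 r) _
  have : Module.IsTorsionFree A K := by
    rw [Module.isTorsionFree_iff_algebraMap_injective, IsScalarTower.algebraMap_eq A E K]
    exact (algebraMap E K).injective.comp (IsFractionRing.injective A E)
  have : Algebra.IsAlgebraic E K := (IsFractionRing.comap_isAlgebraic_iff (A := A) (K := E) (C := K)).1
    ((IsFractionRing.isAlgebraic_iff' A R K).1 inferInstance)
  exact Algebra.IsIntegral.finite

end

/-- A suitable nonzero multiple in `A` makes a primitive element integral without changing the field
it generates. -/
lemma exists_powerBasis_isIntegral_gen (A E L : Type*) [CommRing A] [IsDomain A] [Field E] [Field L]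
    [Algebra A E] [IsFractionRing A E] [Algebra A L] [Algebra E L] [IsScalarTower A E L]
    [FiniteDimensional E L] [Algebra.IsSeparable E L] :
    ∃ pb : PowerBasis E L, IsIntegral A pb.gen := by
  obtain ⟨θ, hθ⟩ := Field.exists_primitive_element E L
  have : Algebra.IsAlgebraic A L :=
    (IsFractionRing.comap_isAlgebraic_iff (A := A) (K := E) (C := L)).2 inferInstance
  obtain ⟨d, hd, h⟩ := (Algebra.IsAlgebraic.isAlgebraic (R := A) θ).exists_integral_multiple
  have htop : Algebra.adjoin E {d • θ} = ⊤ := by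
    rw [IntermediateField.adjoin_eq_top_iff] at hθ
    rw [eq_top_iff, ← hθ]
    refine Algebra.adjoin_singleton_le ?_
    have hd' : algebraMap A E d ≠ 0 := by simpa using hd
    have := Subalgebra.smul_mem _ (Algebra.self_mem_adjoin_singleton E (d • θ)) (algebraMap A E d)⁻¹
    rwa [← algebraMap_smul E d θ, smul_smul, inv_mul_cancel₀ hd', one_smul,
      algebraMap_smul] at this
  exact ⟨PowerBasis.ofAdjoinEqTop (Algebra.IsIntegral.isIntegral _) htop, h⟩

section ClosedPoint

variable {F R K L : Type*} [Field F] [CharZero F] [CommRing R] [Field K] [Field L]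
  [Algebra F[X] R] [FaithfulSMul F[X] R] [Algebra.IsAlgebraic F[X] R] [Algebra.FiniteType F[X] R]
  [Algebra R K] [IsFractionRing R K] [Algebra K L] [FiniteDimensional K L]

/-- Hilbert irreducibility on a curve. -/
theorem IsHilbertian.exists_valuation_repr_le (hF : IsHilbertian F) :
    ∃ (pK : PowerBasis K L) (w : Valuation L ℤᵐ⁰) (v : Valuation K ℤᵐ⁰) (c : Ideal R),
      c.IsMaximal ∧ Function.Surjective v ∧ (∀ x, w (algebraMap K L x) = v x) ∧ w pK.gen ≤ 1 ∧
      (∀ x i, v (pK.basis.repr x i) ≤ w x) ∧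
      ∀ x, v x ≤ 1 ↔ ∃ b d : R, d ∉ c ∧ algebraMap R K d * x = algebraMap R K b := by
  classical
  let E := FractionRing F[X]
  let _ : Algebra F[X] K := ((algebraMap R K).comp (algebraMap F[X] R)).toAlgebra
  have : IsScalarTower F[X] R K := IsScalarTower.of_algebraMap_eq fun _ => rfl
  have : FaithfulSMul F[X] K := (faithfulSMul_iff_algebraMap_injective _ _).2
    ((IsFractionRing.injective R K).comp (FaithfulSMul.algebraMap_injective F[X] R))
  let _ : Algebra E K := FractionRing.liftAlgebra F[X] K
  have : IsScalarTower F[X] E K := inferInstance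
  let _ : Algebra E L := ((algebraMap K L).comp (algebraMap E K)).toAlgebra
  have : IsScalarTower E K L := IsScalarTower.of_algebraMap_eq fun _ => rfl
  let _ : Algebra F[X] L := ((algebraMap K L).comp (algebraMap F[X] K)).toAlgebra
  have : IsScalarTower F[X] K L := IsScalarTower.of_algebraMap_eq fun _ => rfl
  have : IsScalarTower F[X] E L := IsScalarTower.of_algebraMap_eq fun x => by
    rw [IsScalarTower.algebraMap_apply F[X] K L, IsScalarTower.algebraMap_apply F[X] E K]
    rfl
  have : FiniteDimensional E K := finiteDimensional_of_finiteType_of_isAlgebraic (A := F[X]) (R := R) E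
  have : FiniteDimensional E L := FiniteDimensional.trans E K L
  have : CharZero E := charZero_of_injective_algebraMap (IsFractionRing.injective F[X] E)
  obtain ⟨pE, hint⟩ := exists_powerBasis_isIntegral_gen F[X] E L
  have htop : Algebra.adjoin K {pE.gen} = ⊤ := by
    rw [eq_top_iff]
    intro x _
    have hx : x ∈ Algebra.adjoin E {pE.gen} := pE.adjoin_gen_eq_top ▸ Algebra.mem_top
    have hle : Algebra.adjoin E {pE.gen} ≤ (Algebra.adjoin K {pE.gen}).restrictScalars E :=
      Algebra.adjoin_singleton_le (Algebra.self_mem_adjoin_singleton K _)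
    exact hle hx
  let pK : PowerBasis K L := PowerBasis.ofAdjoinEqTop (Algebra.IsIntegral.isIntegral _) htop
  obtain ⟨s, hs⟩ := Algebra.FiniteType.out (R := F[X]) (A := R)
  obtain ⟨D₁, hD₁, h₁⟩ := exists_algebraMap_mul_eq_algebraMap_of_finite (A := F[X]) (R := F[X])
    fun x : s × Fin pE.dim => pE.basis.repr (algebraMap K L (algebraMap R K x.1)) x.2
  obtain ⟨D₂, hD₂, h₂⟩ := exists_algebraMap_mul_eq_algebraMap_of_finite (A := F[X]) (R := R)
    fun x : Fin pE.dim × Fin pK.dim => pK.basis.repr (pE.gen ^ (x.1 : ℕ)) x.2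
  -- The excluded values are the zeros of the denominators: `D₁` for the `E`-coordinates of the
  -- generators of `R`, `D₂` for the `K`-coordinates of the powers of `θ`.
  obtain ⟨a, ha, hirr⟩ := hF (minpoly F[X] pE.gen) (minpoly.monic hint) (minpoly.irreducible hint)
    (D₁ * D₂).roots.toFinset
  refine ⟨pK, exists_valuation_of_irreducible_eval pE pK rfl hint hirr (D := D₁ * D₂) ?_ hs ?_ ?_⟩
  · intro h
    exact ha (Multiset.mem_toFinset.2 ((mem_roots (mul_ne_zero hD₁ hD₂)).2 h))
  · intro r hr i
    obtain ⟨p, hp⟩ := h₁ ⟨⟨r, hr⟩, i⟩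
    exact ⟨D₂ * p, by rw [mul_comm D₁, map_mul, map_mul, mul_assoc, hp]⟩
  · intro i j
    obtain ⟨r, hr⟩ := h₂ ⟨i, j⟩
    refine ⟨algebraMap F[X] R D₁ * r, ?_⟩
    rw [map_mul, map_mul, mul_assoc, hr, IsScalarTower.algebraMap_apply F[X] R K]

end ClosedPoint

end

/-! ### Curves as algebraic extensions of the affine line -/

section

open Polynomial

section Etale


/-- The extension of fraction fields is formally unramified and essentially of finite type, hence
separable algebraic. -/
lemma Algebra.Etale.isAlgebraic (A R : Type*) [CommRing A] [IsDomain A] [CommRing R] [IsDomain R]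
    [Algebra A R] [FaithfulSMul A R] [Algebra.Etale A R] : Algebra.IsAlgebraic A R := by
  let E := FractionRing A
  let K := FractionRing R
  have : FaithfulSMul A K := (faithfulSMul_iff_algebraMap_injective _ _).2 <| by
    rw [IsScalarTower.algebraMap_eq A R K]
    exact (IsFractionRing.injective R K).comp (FaithfulSMul.algebraMap_injective A R)
  let _ : Algebra E K := FractionRing.liftAlgebra A K
  have : IsScalarTower A E K := inferInstance
  have : Algebra.FormallyUnramified R K :=
    .of_isLocalization (nonZeroDivisors R)
  have : Algebra.FormallyUnramified A K := .comp A R K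
  have : Algebra.FormallyUnramified E K := .of_restrictScalars A E K
  have : Algebra.EssFiniteType R K := .of_isLocalization K (nonZeroDivisors R)
  have : Algebra.EssFiniteType A K := .comp A R K
  have : Algebra.EssFiniteType E K := .of_comp A E K
  have := Algebra.FormallyUnramified.isSeparable E K
  have : Module.IsTorsionFree A K :=
    Module.isTorsionFree_iff_algebraMap_injective.2 (FaithfulSMul.algebraMap_injective A K)
  exact (IsFractionRing.isAlgebraic_iff' A R K).2
    ((IsFractionRing.comap_isAlgebraic_iff (A := A) (K := E) (C := K)).2 inferInstance)

/-- A curve is a finite type algebraic extension of the affine line. -/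
lemma RingHom.IsStandardSmoothOfRelativeDimension.exists_polynomial_algebra
    {k k' R : Type u} [Field k'] [Field k] [CommRing R] [IsDomain R] [Algebra k' k]
    [FiniteDimensional k' k] {φ : k →+* R} (hφ : φ.IsStandardSmoothOfRelativeDimension 1) :
    ∃ _ : Algebra k'[X] R, FaithfulSMul k'[X] R ∧ Algebra.IsAlgebraic k'[X] R ∧
      Algebra.FiniteType k'[X] R := by
  obtain ⟨g, hg, hget⟩ := hφ.exists_etale_mvPolynomial
  let e := MvPolynomial.uniqueAlgEquiv k (Fin 1)
  let h : k[X] →+* R := g.comp e.symm.toRingEquiv.toRingHom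
  have hh : h.Etale :=
    RingHom.Etale.stableUnderComposition e.symm.toRingEquiv.toRingHom g
      (.of_bijective e.symm.bijective) hget
  let _ : Algebra k[X] R := h.toAlgebra
  have : Algebra.Etale k[X] R := hh
  have : FaithfulSMul k[X] R := by
    have := Module.Flat.isTorsionFree (R := k[X]) (M := R)
    exact (faithfulSMul_iff_algebraMap_injective _ _).2
      (Module.isTorsionFree_iff_algebraMap_injective.1 inferInstance)
  have := Algebra.Etale.isAlgebraic k[X] R
  -- The curve is étale over the line over `k`, which is in turn algebraic and of finite type over
  -- the line over the Hilbertian field `k'`.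
  let _ : Algebra k'[X] k[X] := Polynomial.algebra k' k
  let _ : Algebra k'[X] R := (h.comp (algebraMap k'[X] k[X])).toAlgebra
  have : IsScalarTower k'[X] k[X] R := IsScalarTower.of_algebraMap_eq fun _ => rfl
  let _ : Algebra k' R := (h.comp (algebraMap k' k[X])).toAlgebra
  have : IsScalarTower k' k'[X] R := IsScalarTower.of_algebraMap_eq fun x => by
    change h (algebraMap k' k[X] x) = h (mapRingHom (algebraMap k' k) (C x))
    rw [coe_mapRingHom, map_C]
    rfl
  refine ⟨inferInstance, ?_, ?_, ?_⟩
  · rw [faithfulSMul_iff_algebraMap_injective, IsScalarTower.algebraMap_eq k'[X] k[X] R]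
    exact (FaithfulSMul.algebraMap_injective k[X] R).comp
      (map_injective _ (algebraMap k' k).injective)
  · exact Algebra.IsAlgebraic.trans k'[X] k[X] R
  · have : Algebra.FiniteType k' R := by
      have : IsScalarTower k' k[X] R := IsScalarTower.of_algebraMap_eq fun _ => rfl
      have : Algebra.FiniteType k' k[X] := .trans (S := k) inferInstance inferInstance
      exact .trans (S := k[X]) inferInstance inferInstance
    exact Algebra.FiniteType.of_restrictScalars_finiteType k' k'[X] R

end Etale

end

/-! ### Affine charts, closed points and local rings of the curve -/

namespace TateShafarevich

section Scheme

variable {X : Scheme.{u}}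

lemma exists_isAffineOpen_isStandardSmoothOfRelativeDimension {k : Type u} [Field k]
    (f : X ⟶ Spec (CommRingCat.of k)) (n : ℕ) [SmoothOfRelativeDimension n f] (C : X.Opens)
    (hC : (C : Set X).Nonempty) :
    ∃ (V : X.Opens) (_ : IsAffineOpen V) (_ : Nonempty V) (_ : V ≤ C) (φ : k →+* Γ(X, V)),
      φ.IsStandardSmoothOfRelativeDimension n := by
  obtain ⟨x, hx⟩ := hC
  obtain ⟨U, -, V, hV, hxV, e, h⟩ :=
    SmoothOfRelativeDimension.exists_isStandardSmoothOfRelativeDimension (n := n) (f := f) x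
  have hU : U = ⊤ := by
    refine top_le_iff.1 fun y _ => ?_
    have : y = f x := Subsingleton.elim (α := PrimeSpectrum k) _ _
    rw [this]
    exact e hxV
  subst hU
  -- Shrink the smooth chart into `C`; localising away from `s` is standard smooth of relative
  -- dimension `0`, so the dimension is kept.
  obtain ⟨s, hsC, hxs⟩ := hV.exists_basicOpen_le ⟨x, hx⟩ hxV
  have := hV.isLocalization_basicOpen s
  let ε : k ≃+* Γ(Spec (CommRingCat.of k), ⊤) :=
    (Scheme.ΓSpecIso (CommRingCat.of k)).commRingCatIsoToRingEquiv.symm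
  have hε : (ε : k →+* Γ(Spec (CommRingCat.of k), ⊤)).IsStandardSmoothOfRelativeDimension 0 :=
    .equiv ε
  have h1 : ((f.appLE ⊤ V e).hom.comp (ε : k →+* _)).IsStandardSmoothOfRelativeDimension n :=
    add_zero n ▸ h.comp hε
  have h2 : (algebraMap Γ(X, V) Γ(X, X.basicOpen s)).IsStandardSmoothOfRelativeDimension 0 :=
    .algebraMap_isLocalizationAway s
  exact ⟨X.basicOpen s, hV.basicOpen s, ⟨⟨x, hxs⟩⟩, hsC, _, zero_add n ▸ h2.comp h1⟩

/-- A point closed in the open set `V` is locally closed in `X`, and in a Jacobson space this makes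
it closed in `X`, hence in `C`. -/
lemma mem_closedPoints_of_isMaximal [JacobsonSpace X] {V C : X.Opens} (hV : IsAffineOpen V)
    (hVC : V ≤ C) (c : Ideal Γ(X, V)) [c.IsMaximal] :
    ∃ x : V, (hV.primeIdealOf x).asIdeal = c ∧ (⟨x, hVC x.2⟩ : C) ∈ closedPoints C := by
  have h1 (p : Spec Γ(X, V)) : hV.isoSpec.hom (hV.isoSpec.inv p) = p := by
    rw [← Scheme.Hom.comp_apply, Iso.inv_hom_id]; rfl
  have h2 (y : V.toScheme) : hV.isoSpec.inv (hV.isoSpec.hom y) = y := by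
    rw [← Scheme.Hom.comp_apply, Iso.hom_inv_id]; rfl
  let P : PrimeSpectrum Γ(X, V) := ⟨c, inferInstance⟩
  let x : V := hV.isoSpec.inv P
  have hx : hV.primeIdealOf x = P := h1 P
  have hinj (y : V) (hy : hV.isoSpec.hom y = P) : y = x :=
    (h2 y).symm.trans (congrArg hV.isoSpec.inv hy)
  refine ⟨x, congrArg _ hx, ?_⟩
  have hP : IsClosed {P} := (PrimeSpectrum.isClosed_singleton_iff_isMaximal P).2 ‹_›
  have hxV : IsClosed {x} := by
    convert! hP.preimage hV.isoSpec.hom.continuous using 1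
    ext y
    exact ⟨fun h => h ▸ hx, fun h => hinj y h⟩
  have hxX : IsClosed {(x : X)} := by
    refine isClosed_singleton_of_isLocallyClosed_singleton ?_
    rw [← Set.image_singleton]
    exact hxV.isLocallyClosed.image V.isOpenEmbedding.isInducing
      V.isOpenEmbedding.isOpen_range.isLocallyClosed
  have := hxX.preimage (continuous_subtype_val (p := fun y => y ∈ C))
  rw [← Set.image_singleton (f := Subtype.val) (a := (⟨x, hVC x.2⟩ : {y // y ∈ C})),
    Set.preimage_image_eq _ Subtype.val_injective] at this
  exact this

lemma isDiscreteValuationAt_of_le_one_iff [IsIntegral X] {V : X.Opens} (hV : IsAffineOpen V)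
    [Nonempty V] (x : V) {v : Valuation X.functionField ℤᵐ⁰} (hv : Function.Surjective v)
    (h : ∀ y, v y ≤ 1 ↔ ∃ b d : Γ(X, V), d ∉ (hV.primeIdealOf x).asIdeal ∧
      algebraMap Γ(X, V) X.functionField d * y = algebraMap Γ(X, V) X.functionField b) :
    IsDiscreteValuationAt X x v := by
  refine ⟨hv, fun y => ?_⟩
  have := hV.isLocalization_stalk x
  have := functionField_isFractionRing_of_isAffineOpen X V hV
  have hst (d : Γ(X, V)) : algebraMap Γ(X, V) X.functionField d =
      algebraMap (X.presheaf.stalk x.1) X.functionField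
        (algebraMap Γ(X, V) (X.presheaf.stalk x.1) d) :=
    IsScalarTower.algebraMap_apply Γ(X, V) (X.presheaf.stalk x.1) X.functionField d
  have hne (d) (hd : d ∉ (hV.primeIdealOf x).asIdeal) :
      algebraMap Γ(X, V) X.functionField d ≠ 0 := fun h0 => hd <| by
    rw [(IsFractionRing.injective Γ(X, V) X.functionField) (h0.trans (map_zero _).symm)]
    exact zero_mem _
  rw [h, RingHom.mem_range]
  constructor
  · rintro ⟨b, d, hd, hbd⟩
    refine ⟨IsLocalization.mk' (X.presheaf.stalk x.1) b
      (⟨d, hd⟩ : (hV.primeIdealOf x).asIdeal.primeCompl), ?_⟩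
    refine mul_left_cancel₀ (hne d hd) ?_
    rw [hbd, hst, hst, ← map_mul, mul_comm, IsLocalization.mk'_spec]
  · rintro ⟨z, rfl⟩
    obtain ⟨b, d, rfl⟩ := IsLocalization.exists_mk'_eq (hV.primeIdealOf x).asIdeal.primeCompl z
    refine ⟨b, d, d.2, ?_⟩
    rw [hst, hst, ← map_mul, mul_comm, IsLocalization.mk'_spec]

end Scheme

end TateShafarevich

theorem mainTheorem9 {k : Type u} [Field k] [CharZero k]
    (hk : (⊤ : IntermediateField ℚ k).FG)
    (X : Scheme.{u}) (f : X ⟶ Spec (CommRingCat.of k)) [IsIntegral X]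
    [SmoothOfRelativeDimension 1 f] [IsProper f] [GeometricallyConnected f]
    (C : X.Opens) (hC : (C : Set X).Nonempty)
    (M : TopRep.{u} ℤ (absoluteGaloisGroup X.functionField))
    [DiscreteTopology M] [Module.Finite ℤ M]
    (hM : Continuous fun p : absoluteGaloisGroup X.functionField × M => M.ρ p.1 p.2) :
    TateShafarevich.Sha X C 1 M = ⊥ := by
  rw [eq_bot_iff]
  intro α hα
  rw [Submodule.mem_bot]
  -- The field `E` depends only on `α`; the closed point and the primitive element of `E` are chosen
  -- afterwards, together.
  obtain ⟨E, hE, hα0⟩ := TateShafarevich.exists_forall_eq_zero_of_resH_eq_zero M hM α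
  obtain ⟨k', _, _, _, hk'⟩ := exists_isHilbertian_finiteDimensional hk
  have : CharZero k' := (algebraMap k' k).charZero
  obtain ⟨V, hV, hVne, hVC, φ, hφ⟩ :=
    TateShafarevich.exists_isAffineOpen_isStandardSmoothOfRelativeDimension f 1 C hC
  have : IsFractionRing Γ(X, V) X.functionField := functionField_isFractionRing_of_isAffineOpen X V hV
  obtain ⟨_, _, _, _⟩ := hφ.exists_polynomial_algebra (k' := k')
  obtain ⟨pb, w, v, c, hc, hv, hwv, hθ, hw, hvc⟩ :=
    hk'.exists_valuation_repr_le (R := Γ(X, V)) (K := X.functionField) (L := E)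
  have : JacobsonSpace X := LocallyOfFiniteType.jacobsonSpace f
  obtain ⟨x, hxc, hx⟩ := TateShafarevich.mem_closedPoints_of_isMaximal hV hVC c
  have hvx := TateShafarevich.isDiscreteValuationAt_of_le_one_iff hV x hv (by rwa [hxc])
  obtain ⟨v', hv', hd⟩ := TateShafarevich.exists_valuation_completedField v
  have hirr := pb.irreducible_map_minpoly_of_valuation_repr_le hwv hθ hw v' hv' hd
  refine hα0 pb (TateShafarevich.CompletedField v) hirr ?_
  simp only [TateShafarevich.Sha, Submodule.mem_iInf] at hα
  exact hα ⟨x, hVC x.2⟩ hx v hvx
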